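/- Let $A\subseteq\mathbb{R}^n$ be a finite non-empty set of $N$ actions with $\|x\|_2\le B$ for all $x\in A$, where $B>0$. Let $\mu$ be a probability distribution on $A$ and $\lambda>0$ such that $\mathbb{E}_{y\sim\mu}[yy^{\top}]-\lambda I$ is positive semidefinite. Put $\gamma_t=\tfrac12 t^{-1/3}$ and $\eta_t=\gamma_t\lambda/B^2$ for $t\ge 1$. The algorithm ComBand proceeds in rounds $t=1,2,\dots$ as follows. Given the loss estimates $\hat L_1,\dots,\hat L_{t-1}\in\mathbb{R}^n$ of the earlier rounds, let $w_t(x)=\exp\bigl(-\eta_t\sum_{i=1}^{t-1}\hat L_i^{\top}x\bigr)$ and $p_t(x)=w_t(x)/\sum_{y\in A}w_t(y)$ for $x\in A$, and $q_t=(1-\gamma_t)p_t+\gamma_t\mu$. The algorithm plays an action $x_t\in A$ sampled from $q_t$, observes only the number $\ell_t=L_t^{\top}x_t$, and sets $\hat L_t=\ell_t\,C_t^{-1}x_t$ with $C_t=\mathbb{E}_{x\sim q_t}[xx^{\top}]$. The loss vectors $L_t\in\mathbb{R}^n$ are chosen by an adaptive, possibly randomized adversary: $L_t$ may depend on $x_1,L_1,\dots,x_{t-1},L_{t-1}$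 and on randomness of the adversary, and the conditional distribution of $x_t$ given $x_1,L_1,\dots,x_{t-1},L_{t-1},L_t$ is $q_t$. Assume that, almost surely, $|L_t^{\top}x|\le 1$ for all $t$ and all $x\in A$. Then there are absolute constants $C_1,C_2>0$ (independent of $n,A,N,B,\mu,\lambda$, the adversary, $T$ and $\delta$) such that for every $T\ge 1$ and every $0<\delta<1$, with probability at least $1-\delta$, the regret $$R_T=\sum_{t=1}^{T}L_t^{\top}x_t-\min_{x\in A}\sum_{t=1}^{T}L_t^{\top}x$$ satisfies both $$R_T\le\left(\frac{\sqrt3\,B}{\sqrt\lambda}\sqrt{\ln\frac{N+2}{\delta}}+n\,\frac{3(e-2)\lambda}{4B^2}+\frac32\right)T^{2/3}+C_1\left(n\frac{\lambda}{B^2}+\left(1+\frac{B^2}{\lambda}\right)\ln\frac{N+2}{\delta}\right)\sqrt T$$ and $$R_T\le C_2\left(\frac{B}{\sqrt\lambda}\sqrt{\ln\frac{N+2}{\delta}}+n\frac{\lambda}{B^2}\right)T^{2/3}.$$ -/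

import Mathlib

open MeasureTheory

noncomputable section

namespace ComBand

/-- The ambient space `ℝⁿ` with its Euclidean norm and scalar product. -/
abbrev Vec (n : ℕ) : Type := EuclideanSpace ℝ (Fin n)

/-- `ν` is (the probability mass function of) a probability distribution on the finite set `A`. -/
structure IsDistribution {n : ℕ} (A : Finset (Vec n)) (ν : Vec n → ℝ) : Prop where
  nonneg : ∀ x ∈ A, 0 ≤ ν x
  sum_eq_one : ∑ x ∈ A, ν x = 1

/-- The matrix `𝔼_{x ∼ q} [x xᵀ]` for a distribution `q` on `A`. -/
def secondMoment {n : ℕ} (A : Finset (Vec n)) (q : Vec n → ℝ) : Matrix (Fin n) (Fin n) ℝ :=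
  ∑ x ∈ A, q x • Matrix.vecMulVec x.ofLp x.ofLp

/-- The exponential weights distribution on `A` with learning rate `η`
and cumulative estimated loss vector `S`:
`p(x) = w(x) / W` with `w(x) = exp (- η Sᵀ x)` and `W = ∑_{y ∈ A} w(y)`. -/
def expWeights {n : ℕ} (A : Finset (Vec n)) (η : ℝ) (S x : Vec n) : ℝ :=
  Real.exp (-η * inner ℝ S x) / ∑ y ∈ A, Real.exp (-η * inner ℝ S y)

/-- The sampling distribution `q = (1 - γ) p + γ ν`, where `ν` is the exploration distribution. -/
def mixed {n : ℕ} (A : Finset (Vec n)) (ν : Vec n → ℝ) (γ η : ℝ) (S x : Vec n) : ℝ :=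
  (1 - γ) * expWeights A η S x + γ * ν x

/-- The loss estimator `ℓ C⁻¹ x` with `C = 𝔼_{y ∼ q} [y yᵀ]`,
for the played action `x` and the observed loss `ℓ`. -/
def lossEstimate {n : ℕ} (A : Finset (Vec n)) (q : Vec n → ℝ) (ℓ : ℝ) (x : Vec n) : Vec n :=
  WithLp.toLp 2 (ℓ • Matrix.mulVec (secondMoment A q)⁻¹ x.ofLp)

/-- The cumulative estimated loss vector after `k` rounds of the algorithm, for the
sequences `γ`, `η` of parameters, the played actions `xs` and the observed losses `ℓs`.
Rounds are numbered `0, 1, 2, …`. -/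
def cumEstimate {n : ℕ} (A : Finset (Vec n)) (ν : Vec n → ℝ) (γ η : ℕ → ℝ)
    (xs : ℕ → Vec n) (ℓs : ℕ → ℝ) : ℕ → Vec n
  | 0 => 0
  | k + 1 =>
    cumEstimate A ν γ η xs ℓs k +
      lossEstimate A (mixed A ν (γ k) (η k) (cumEstimate A ν γ η xs ℓs k)) (ℓs k) (xs k)

/-- The distribution from which the algorithm samples its action in round `k`, as a function of
the actions and observed losses of the earlier rounds. -/
def sampling {n : ℕ} (A : Finset (Vec n)) (ν : Vec n → ℝ) (γ η : ℕ → ℝ)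
    (xs : ℕ → Vec n) (ℓs : ℕ → ℝ) (k : ℕ) : Vec n → ℝ :=
  mixed A ν (γ k) (η k) (cumEstimate A ν γ η xs ℓs k)

/-- The σ-algebra generated by the actions and loss vectors of all rounds before round `k`
and by the loss vector of round `k`. -/
abbrev preHistory {n : ℕ} {Ω : Type*} (X L : ℕ → Ω → Vec n) (k : ℕ) : MeasurableSpace Ω :=
  (⨆ i : ℕ, ⨆ _ : i < k,
      MeasurableSpace.comap (X i) inferInstance ⊔ MeasurableSpace.comap (L i) inferInstance) ⊔
    MeasurableSpace.comap (L k) inferInstance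

/-- `X` (actions) and `L` (loss vectors) are the random outcomes of running the algorithm against
an adaptive, possibly randomized adversary: the loss vector of round `k` may depend in any way on
everything that happened before round `k` (and on randomness of the adversary), and, conditionally
on the past and on the current loss vector, the action of round `k` has the distribution `sampling`,
which is computed from the past actions and their observed losses `(L i)ᵀ (X i)` only. -/
structure IsRun {n : ℕ} (A : Finset (Vec n)) (ν : Vec n → ℝ) (γ η : ℕ → ℝ)
    {Ω : Type*} [MeasurableSpace Ω] (P : Measure Ω) (X L : ℕ → Ω → Vec n) : Prop where
  measurable_action : ∀ k, Measurable (X k)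
  measurable_loss : ∀ k, Measurable (L k)
  action_mem : ∀ k ω, X k ω ∈ A
  sample : ∀ k, ∀ a ∈ A,
    P[(X k ⁻¹' {a}).indicator (fun _ => (1 : ℝ)) | preHistory X L k] =ᵐ[P]
      fun ω => sampling A ν γ η (fun i => X i ω) (fun i => inner ℝ (L i ω) (X i ω)) k a

/-- The regret after `T` rounds of the actions `xs` for the loss vectors `Ls`,
relative to the best fixed action of `A` in hindsight. -/
def regret {n : ℕ} (A : Finset (Vec n)) (hA : A.Nonempty) (xs Ls : ℕ → Vec n) (T : ℕ) : ℝ :=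
  ∑ k ∈ Finset.range T, inner ℝ (Ls k) (xs k) -
    A.inf' hA fun x => ∑ k ∈ Finset.range T, inner ℝ (Ls k) x

/-- The exploration rate `t^(-1/3) / 2`; round `k` is the `t`-th round for `t = k + 1`. -/
def explorationRate (k : ℕ) : ℝ := ((k : ℝ) + 1) ^ (-(1 / 3) : ℝ) / 2

/-- The learning rate `γ lam / B ^ 2`, where `γ` is the exploration rate of the same round. -/
def learningRate (lam B : ℝ) (k : ℕ) : ℝ := explorationRate k * lam / B ^ 2

end ComBand

end

/-! The algorithm is exponential weights run on estimated losses. A potential argument bounds the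
estimated loss of the weights `p` by that of any fixed action `x`, plus `ln N / η_T`, plus `(e - 2)`
times a second order term (`expWeights_regret_le`). Passing back to true losses leaves three random
sums (`ComBand.regret_decomposition`): `weightsGap` (incurred loss against estimated loss of `p`),
`secondOrder`, and `estimateGap` (estimated against true loss of `x`).

Each summand depends on the past and on the freshly drawn action, so its conditional moments are
finite sums over `A`. They follow from `C C⁻¹ = I`, from `C ≥ γ λ I`, which the exploration
guarantees, and from `p ≤ q / (1 - γ)`. The estimator is unbiased with variance at most `B² / (γ
λ)`; `weightsGap` has mean at most `2 γ` and second moment at most `6`, free of `n` and `λ`; the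
mean of `secondOrder` is a trace, `η n / (1 - γ)`. All these bounds are deterministic, so a
Bernstein inequality for adaptive sampling (`measureReal_bernstein_le`) applies to the two common
sums and to the `N` sums `estimateGap`; hence `ln ((N + 2) / δ)`.

For `γ_t = t^(-1/3) / 2`, both `∑ γ_t` and `√(∑ 1 / γ_t)` have order `T^(2/3)`, and they produce the
three leading terms. The rest is of order `√T` or `T^(1/3)`. In the second bound it is absorbed
unless `(B² / λ) ln ((N + 2) / δ) > T^(2/3)`, and then the trivial bound `2 T` suffices. -/

/-! ### Elementary estimates of the exponential function. -/

/-- The estimate `eʸ ≤ 1 + y + (e - 2) y²` for `|y| ≤ 1`. -/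
lemma Real.exp_le_one_add_add_mul_sq {y : ℝ} (hy : |y| ≤ 1) :
    Real.exp y ≤ 1 + y + (Real.exp 1 - 2) * y ^ 2 := by
  obtain ⟨h1, h2⟩ := abs_le.mp hy
  rcases le_or_gt 0 y with h | h
  · have e1 : HasSum (fun k : ℕ => y ^ k / (k.factorial : ℝ)) (Real.exp y) := by
      rw [Real.exp_eq_exp_ℝ]
      exact NormedSpace.expSeries_div_hasSum_exp y
    have e2 : HasSum (fun k : ℕ => (1 : ℝ) ^ k / (k.factorial : ℝ)) (Real.exp 1) := by
      rw [Real.exp_eq_exp_ℝ]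
      exact NormedSpace.expSeries_div_hasSum_exp (1 : ℝ)
    -- The majorant has terms `y² / k!`, with the terms `k = 0, 1` corrected to `1` and `y`; its sum
    -- is the right-hand side.
    have e3 := ((e2.mul_left (y ^ 2)).add (hasSum_ite_eq 0 (1 - y ^ 2))).add
      (hasSum_ite_eq 1 (y - y ^ 2))
    refine (hasSum_le (fun k => ?_) e1 e3).trans (le_of_eq (by ring))
    rcases k with _ | _ | k
    · simp
    · simp
    · simp only [one_pow, Nat.add_eq_zero_iff, one_ne_zero, and_false, if_false, add_zero,
        Nat.add_eq_right]
      rw [div_eq_mul_one_div]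
      have : y ^ (k + 1 + 1) ≤ y ^ 2 := pow_le_pow_of_le_one h h2 (by omega)
      gcongr
  · have e2 := Real.quadratic_le_exp_of_nonneg (x := -y) (by linarith)
    have e3 : (2.7 : ℝ) < Real.exp 1 := by linarith [Real.exp_one_gt_d9]
    have e4 : Real.exp y * Real.exp (-y) = 1 := by rw [← Real.exp_add]; simp
    have e5 : Real.exp y * (1 + -y + (-y) ^ 2 / 2) ≤ 1 :=
      (mul_le_mul_of_nonneg_left e2 (Real.exp_pos y).le).trans_eq e4
    -- Here `(1 + y² / 2)² - y² = 1 + y⁴ / 4 ≥ 1`; the final step uses `1/2 ≤ e - 2`.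
    have e6 : Real.exp y ≤ 1 + y + y ^ 2 / 2 := by
      refine le_of_mul_le_mul_right (a := 1 + -y + (-y) ^ 2 / 2) (e5.trans ?_)
        (by nlinarith [sq_nonneg y])
      nlinarith [sq_nonneg (y ^ 2)]
    nlinarith [mul_nonneg (sq_nonneg y) (by linarith : (0:ℝ) ≤ Real.exp 1 - 2.7), sq_nonneg y]

/-- A second order estimate of the exponential function with the sharp quadratic term. -/
lemma Real.exp_le_one_add_add_sq_div_two_mul {y : ℝ} (hy : |y| ≤ 1) :
    Real.exp y ≤ 1 + y + y ^ 2 / 2 * (1 + |y|) := by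
  have e1 := Real.exp_bound hy (n := 3) (by norm_num)
  simp only [Finset.sum_range_succ, Finset.sum_range_zero] at e1
  norm_num [Nat.factorial] at e1
  have e4 := (abs_le.mp e1).2
  have e5 : |y| ^ 3 = y ^ 2 * |y| := by rw [pow_succ, sq_abs]
  have e6 : 0 ≤ y ^ 2 * |y| := by positivity
  nlinarith

/-! ### Sums of powers of cube roots. -/

/-- The real cube root of a natural number. -/
noncomputable def cubeRoot (k : ℕ) : ℝ := (k : ℝ) ^ (1 / 3 : ℝ)

lemma cubeRoot_nonneg (k : ℕ) : 0 ≤ cubeRoot k := by unfold cubeRoot; positivity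

lemma cubeRoot_pow_three (k : ℕ) : cubeRoot k ^ 3 = k := by
  unfold cubeRoot
  rw [← Real.rpow_natCast, ← Real.rpow_mul (by positivity)]
  norm_num

lemma cubeRoot_pow_two (k : ℕ) : cubeRoot k ^ 2 = (k : ℝ) ^ (2 / 3 : ℝ) := by
  unfold cubeRoot
  rw [← Real.rpow_natCast, ← Real.rpow_mul (by positivity)]
  norm_num

lemma cubeRoot_zero : cubeRoot 0 = 0 := by simp [cubeRoot]

lemma cubeRoot_mono : Monotone cubeRoot := fun a b h => by
  unfold cubeRoot
  have : (a : ℝ) ≤ b := by exact_mod_cast h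
  gcongr

lemma one_le_cubeRoot_succ (k : ℕ) : 1 ≤ cubeRoot (k + 1) := by
  unfold cubeRoot
  refine Real.one_le_rpow ?_ (by norm_num)
  push_cast
  linarith [k.cast_nonneg (α := ℝ)]

lemma cubeRoot_succ_pow_three (k : ℕ) : cubeRoot (k + 1) ^ 3 = cubeRoot k ^ 3 + 1 := by
  simp [cubeRoot_pow_three]

/-- Comparison with an integral, done by telescoping. For `b³ = a³ + 1` the increment reduces to
`3b⁴ - 4ab³ + a⁴ ≥ 0`, which has the double root `b = a`. The next two sums use `b³ - 3a²b + 2a³`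
and `2b³ - 3ab² + a³` in the same way. -/
lemma sum_cubeRoot_le (T : ℕ) :
    ∑ k ∈ Finset.range T, cubeRoot (k + 1) ≤ 3 / 4 * cubeRoot T ^ 4 + cubeRoot T := by
  induction T with
  | zero => simp [cubeRoot_zero]
  | succ k ih =>
    rw [Finset.sum_range_succ]
    have h := cubeRoot_succ_pow_three k
    have h0 := cubeRoot_nonneg k
    have h1 := one_le_cubeRoot_succ k
    set a := cubeRoot k
    set b := cubeRoot (k + 1)
    have h2 : 0 ≤ (b - a) ^ 2 * (3 * b ^ 2 + 2 * a * b + a ^ 2) := by positivity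
    have h3 : a * b ^ 3 = a * (a ^ 3 + 1) := by rw [h]
    nlinarith

lemma sum_inv_cubeRoot_le (T : ℕ) :
    ∑ k ∈ Finset.range T, (cubeRoot (k + 1))⁻¹ ≤ 3 / 2 * cubeRoot T ^ 2 := by
  induction T with
  | zero => simp [cubeRoot_zero]
  | succ k ih =>
    rw [Finset.sum_range_succ]
    have h := cubeRoot_succ_pow_three k
    have h0 := cubeRoot_nonneg k
    have h1 := one_le_cubeRoot_succ k
    set a := cubeRoot k
    set b := cubeRoot (k + 1)
    have hb : 0 < b := by linarith
    have h2 : 0 ≤ (b - a) ^ 2 * (b + 2 * a) := by positivity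
    have h3 : b⁻¹ ≤ 3 / 2 * (b ^ 2 - a ^ 2) := by
      rw [inv_le_iff_one_le_mul₀ hb]
      nlinarith
    linarith

lemma sum_inv_cubeRoot_sq_le (T : ℕ) :
    ∑ k ∈ Finset.range T, (cubeRoot (k + 1))⁻¹ ^ 2 ≤ 3 * cubeRoot T := by
  induction T with
  | zero => simp [cubeRoot_zero]
  | succ k ih =>
    rw [Finset.sum_range_succ]
    have h := cubeRoot_succ_pow_three k
    have h0 := cubeRoot_nonneg k
    have h1 := one_le_cubeRoot_succ k
    set a := cubeRoot k
    set b := cubeRoot (k + 1)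
    have hb : 0 < b := by linarith
    have h2 : 0 ≤ (b - a) ^ 2 * (2 * b + a) := by positivity
    have h3 : b⁻¹ ^ 2 ≤ 3 * (b - a) := by
      rw [inv_pow, inv_le_iff_one_le_mul₀ (by positivity)]
      nlinarith
    linarith

/-! ### Exponential weights with decreasing learning rates. -/

/-- The potential `-(1/η) log ((1/N) ∑ exp (-η S))` is nonincreasing in `η`. -/
lemma log_mean_exp_div_mono {ι : Type*} (A : Finset ι) (hA : A.Nonempty) (S : ι → ℝ) {a b : ℝ}
    (ha : 0 < a) (hab : a ≤ b) :
    Real.log (∑ x ∈ A, (A.card : ℝ)⁻¹ * Real.exp (-a * S x)) / a ≤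
      Real.log (∑ x ∈ A, (A.card : ℝ)⁻¹ * Real.exp (-b * S x)) / b := by
  have hc : (0 : ℝ) < A.card := by exact_mod_cast hA.card_pos
  have hb : 0 < b := ha.trans_le hab
  -- Power mean inequality with exponent `b / a ≥ 1`; it needs weights of total mass one, hence the
  -- factor `1 / N`.
  have key := Real.rpow_arith_mean_le_arith_mean_rpow A (fun _ => (A.card : ℝ)⁻¹)
    (fun x => Real.exp (-a * S x)) (fun _ _ => by positivity)
    (by simp [hc.ne']) (fun _ _ => (Real.exp_pos _).le) (p := b / a) ((one_le_div ha).mpr hab)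
  have e : ∀ x, Real.exp (-a * S x) ^ (b / a) = Real.exp (-b * S x) := fun x => by
    rw [← Real.exp_mul]; congr 1; field_simp
  simp only [e] at key
  have hpos : 0 < ∑ x ∈ A, (A.card : ℝ)⁻¹ * Real.exp (-a * S x) :=
    Finset.sum_pos (fun _ _ => by positivity) hA
  have k2 := Real.log_le_log (by positivity) key
  rw [Real.log_rpow hpos] at k2
  rw [div_le_div_iff₀ ha hb]
  rw [div_mul_eq_mul_div, div_le_iff₀ ha] at k2
  linarith

/-- Regret of exponential weights with nonincreasing learning rates, with the second order term. -/
theorem expWeights_regret_le {ι : Type*} (A : Finset ι) (hA : A.Nonempty) (η : ℕ → ℝ)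
    (hη : ∀ k, 0 < η k) (hanti : ∀ k, η (k + 1) ≤ η k) (S z p : ℕ → ι → ℝ)
    (hS0 : ∀ x, S 0 x = 0) (hS : ∀ k x, S (k + 1) x = S k x + z k x)
    (hp : ∀ k x, p k x = Real.exp (-η k * S k x) / ∑ y ∈ A, Real.exp (-η k * S k y))
    (T : ℕ) (hz : ∀ k < T, ∀ x ∈ A, |η k * z k x| ≤ 1) {x : ι} (hx : x ∈ A) :
    ∑ k ∈ Finset.range T, ∑ y ∈ A, p k y * z k y ≤
      S T x + Real.log A.card / η T +
        (Real.exp 1 - 2) * ∑ k ∈ Finset.range T, η k * ∑ y ∈ A, p k y * z k y ^ 2 := by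
  have hc : (0 : ℝ) < A.card := by exact_mod_cast hA.card_pos
  set Φ : ℕ → ℝ → ℝ := fun k a =>
    Real.log (∑ x ∈ A, (A.card : ℝ)⁻¹ * Real.exp (-a * S k x)) / a with hΦ
  have hWpos : ∀ k a, 0 < ∑ y ∈ A, Real.exp (-a * S k y) := fun k a =>
    Finset.sum_pos (fun _ _ => Real.exp_pos _) hA
  have hp1 : ∀ k, ∑ y ∈ A, p k y = 1 := fun k => by
    simp only [hp, ← Finset.sum_div]; exact div_self (hWpos k _).ne'
  have hp0 : ∀ k y, 0 ≤ p k y := fun k y => by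
    rw [hp]; exact div_nonneg (Real.exp_pos _).le (hWpos k _).le
  have step : ∀ k < T, Φ (k + 1) (η k) - Φ k (η k) ≤
      -(∑ y ∈ A, p k y * z k y) + (Real.exp 1 - 2) * (η k * ∑ y ∈ A, p k y * z k y ^ 2) := by
    intro k hk
    have h1 : ∑ y ∈ A, Real.exp (-η k * S (k + 1) y) =
        (∑ y ∈ A, Real.exp (-η k * S k y)) * ∑ y ∈ A, p k y * Real.exp (-(η k * z k y)) := by
      rw [Finset.mul_sum]
      refine Finset.sum_congr rfl fun y _ => ?_
      rw [hp, hS, div_mul_eq_mul_div, mul_div_cancel₀ _ (hWpos k _).ne', ← Real.exp_add]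
      congr 1; ring
    have h2 : 0 < ∑ y ∈ A, p k y * Real.exp (-(η k * z k y)) := by
      have := hWpos (k + 1) (η k)
      rw [h1] at this
      exact (pos_iff_pos_of_mul_pos this).mp (hWpos k _)
    have h3 : Φ (k + 1) (η k) - Φ k (η k) =
        Real.log (∑ y ∈ A, p k y * Real.exp (-(η k * z k y))) / η k := by
      simp only [hΦ, ← Finset.mul_sum]
      rw [h1, ← mul_assoc, Real.log_mul (mul_pos (by positivity) (hWpos k _)).ne' h2.ne']
      ring
    rw [h3, div_le_iff₀ (hη k)]
    refine (Real.log_le_sub_one_of_pos h2).trans ?_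
    have h4 : ∑ y ∈ A, p k y * Real.exp (-(η k * z k y)) ≤
        ∑ y ∈ A, (p k y - η k * (p k y * z k y) +
          (Real.exp 1 - 2) * η k ^ 2 * (p k y * z k y ^ 2)) := by
      refine Finset.sum_le_sum fun y hy => ?_
      have := Real.exp_le_one_add_add_mul_sq (y := -(η k * z k y)) (by
        rw [abs_neg]; exact hz k hk y hy)
      refine (mul_le_mul_of_nonneg_left this (hp0 k y)).trans (le_of_eq (by ring))
    rw [Finset.sum_add_distrib, Finset.sum_sub_distrib, hp1, ← Finset.mul_sum,
      ← Finset.mul_sum] at h4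
    nlinarith
  -- Lowering the rate with the estimates held fixed does not raise the potential, so the
  -- telescoping sum survives and `ln N` is paid only once, at the end.
  have mono : ∀ k, Φ (k + 1) (η (k + 1)) ≤ Φ (k + 1) (η k) := fun k =>
    log_mean_exp_div_mono A hA (S (k + 1)) (hη _) (hanti k)
  have start : Φ 0 (η 0) = 0 := by simp [hΦ, hS0, hc.ne']
  have tele : Φ T (η T) ≤ ∑ k ∈ Finset.range T, (-(∑ y ∈ A, p k y * z k y) +
      (Real.exp 1 - 2) * (η k * ∑ y ∈ A, p k y * z k y ^ 2)) := by
    have : Φ T (η T) = ∑ k ∈ Finset.range T, (Φ (k + 1) (η (k + 1)) - Φ k (η k)) := by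
      rw [Finset.sum_range_sub (fun k => Φ k (η k)), start, sub_zero]
    rw [this]
    refine Finset.sum_le_sum fun k hk => ?_
    linarith [step k (Finset.mem_range.mp hk), mono k]
  -- One summand bounds the mean from below. The rate `η T` is that of the round after the last one
  -- played.
  have last : -(S T x) - Real.log A.card / η T ≤ Φ T (η T) := by
    simp only [hΦ]
    rw [le_div_iff₀ (hη T)]
    have h1 : (A.card : ℝ)⁻¹ * Real.exp (-η T * S T x) ≤
        ∑ y ∈ A, (A.card : ℝ)⁻¹ * Real.exp (-η T * S T y) :=
      Finset.single_le_sum (f := fun y => (A.card : ℝ)⁻¹ * Real.exp (-η T * S T y))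
        (fun _ _ => by positivity) hx
    have h2 := Real.log_le_log (by positivity) h1
    rw [Real.log_mul (by positivity) (Real.exp_pos _).ne', Real.log_exp, Real.log_inv] at h2
    refine le_trans (le_of_eq ?_) h2
    have := (hη T).ne'
    field_simp
    ring
  rw [Finset.sum_add_distrib, Finset.sum_neg_distrib, ← Finset.mul_sum] at tele
  linarith

/-! ### Bernstein inequality for adaptively sampled actions. -/

/-- The exponential moment of a random variable with finitely many values, in terms of bounds for
its first two moments. -/
lemma sum_mul_exp_le {α : Type*} (A : Finset α) (q f : α → ℝ) (hq0 : ∀ a ∈ A, 0 ≤ q a)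
    (hq1 : ∑ a ∈ A, q a = 1) {m v b s : ℝ} (hs : 0 ≤ s) (hsb : s * b ≤ 1)
    (hb : ∀ a ∈ A, |f a| ≤ b) (hm : ∑ a ∈ A, q a * f a ≤ m)
    (hv : ∑ a ∈ A, q a * f a ^ 2 ≤ v) :
    ∑ a ∈ A, q a * Real.exp (s * (f a - m)) ≤ Real.exp (s ^ 2 * (1 + s * b) / 2 * v) := by
  have h1 : ∀ a ∈ A, q a * Real.exp (s * f a) ≤
      q a + s * (q a * f a) + s ^ 2 * (1 + s * b) / 2 * (q a * f a ^ 2) := by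
    intro a ha
    have h0 : |s * f a| ≤ s * b := by
      rw [abs_mul, abs_of_nonneg hs]; exact mul_le_mul_of_nonneg_left (hb a ha) hs
    have h2 := Real.exp_le_one_add_add_sq_div_two_mul (h0.trans hsb)
    have h3 : (s * f a) ^ 2 / 2 * (1 + |s * f a|) ≤ (s * f a) ^ 2 / 2 * (1 + s * b) := by
      gcongr
    refine (mul_le_mul_of_nonneg_left (h2.trans (add_le_add_right h3 _)) (hq0 a ha)).trans
      (le_of_eq (by ring))
  have hsb0 : 0 ≤ s * b := by
    obtain ⟨a, ha⟩ : A.Nonempty := by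
      rw [Finset.nonempty_iff_ne_empty]; rintro rfl; simp at hq1
    exact mul_nonneg hs ((abs_nonneg _).trans (hb a ha))
  have h2 : ∑ a ∈ A, q a * Real.exp (s * f a) ≤ 1 + s * m + s ^ 2 * (1 + s * b) / 2 * v := by
    refine (Finset.sum_le_sum h1).trans ?_
    rw [Finset.sum_add_distrib, Finset.sum_add_distrib, hq1, ← Finset.mul_sum, ← Finset.mul_sum]
    gcongr
  have h3 : ∑ a ∈ A, q a * Real.exp (s * (f a - m)) =
      (∑ a ∈ A, q a * Real.exp (s * f a)) * Real.exp (-(s * m)) := by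
    rw [Finset.sum_mul]
    refine Finset.sum_congr rfl fun a _ => ?_
    rw [mul_assoc, ← Real.exp_add]; congr 2; ring
  rw [h3]
  have h4 : 1 + s * m + s ^ 2 * (1 + s * b) / 2 * v ≤
      Real.exp (s * m + s ^ 2 * (1 + s * b) / 2 * v) := by
    linarith [Real.add_one_le_exp (s * m + s ^ 2 * (1 + s * b) / 2 * v)]
  refine (mul_le_mul_of_nonneg_right (h2.trans h4) (Real.exp_pos _).le).trans (le_of_eq ?_)
  rw [← Real.exp_add]; congr 1; ring

section Bernstein

variable {Ω α : Type*} [mΩ : MeasurableSpace Ω] [MeasurableSpace α] [MeasurableSingletonClass α]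

/-- Integration of a function of the past and of an action whose conditional distribution given
the past is `q`. -/
lemma integral_comp_action (P : Measure Ω) [IsProbabilityMeasure P] (m : MeasurableSpace Ω)
    (hm : m ≤ mΩ) (A : Finset α) (X : Ω → α) (hX : Measurable[mΩ] X) (hXA : ∀ ω, X ω ∈ A)
    (q g : α → Ω → ℝ)
    (hq : ∀ a ∈ A, P[(X ⁻¹' {a}).indicator (fun _ => (1 : ℝ)) | m] =ᵐ[P] q a)
    (hg : ∀ a ∈ A, Measurable[m] (g a)) (hgi : ∀ a ∈ A, Integrable (g a) P) :
    Integrable (fun ω => g (X ω) ω) P ∧ (∀ a ∈ A, Integrable (fun ω => q a ω * g a ω) P) ∧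
      ∫ ω, g (X ω) ω ∂P = ∫ ω, ∑ a ∈ A, q a ω * g a ω ∂P := by
  classical
  have hmeas : ∀ a, MeasurableSet[mΩ] (X ⁻¹' {a}) := fun a => hX (measurableSet_singleton a)
  have hind : ∀ a ∈ A, Integrable (g a * (X ⁻¹' {a}).indicator (fun _ => (1 : ℝ))) P := by
    intro a ha
    have : g a * (X ⁻¹' {a}).indicator (fun _ => (1 : ℝ)) = (X ⁻¹' {a}).indicator (g a) := by
      ext ω; simp [Set.indicator_apply]
    rw [this]
    exact (hgi a ha).indicator (hmeas a)
  have hce : ∀ a ∈ A, P[g a * (X ⁻¹' {a}).indicator (fun _ => (1 : ℝ)) | m] =ᵐ[P]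
      fun ω => q a ω * g a ω := by
    intro a ha
    refine (condExp_mul_of_stronglyMeasurable_left (hg a ha).stronglyMeasurable (hind a ha)
      ((integrable_const _).indicator (hmeas a))).trans ?_
    filter_upwards [hq a ha] with ω hω
    simp [hω, mul_comm]
  -- Splitting by the value of the action leaves products of a function known from the past with an
  -- indicator, so the former can be pulled out of the conditional expectation.
  have hsum : (fun ω => g (X ω) ω) =
      fun ω => ∑ a ∈ A, (g a * (X ⁻¹' {a}).indicator (fun _ => (1 : ℝ))) ω := by
    ext ω
    rw [Finset.sum_eq_single_of_mem (X ω) (hXA ω)]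
    · simp
    · intro a _ ha
      simp [Ne.symm ha]
  have hqi : ∀ a ∈ A, Integrable (fun ω => q a ω * g a ω) P := fun a ha =>
    integrable_condExp.congr (hce a ha)
  refine ⟨?_, hqi, ?_⟩
  · rw [hsum]; exact integrable_finsetSum _ hind
  · rw [hsum, integral_finsetSum _ hind, integral_finsetSum _ hqi]
    refine Finset.sum_congr rfl fun a ha => ?_
    rw [← integral_congr_ae (hce a ha), integral_condExp hm]

variable (P : Measure Ω) [IsProbabilityMeasure P] (F : ℕ → MeasurableSpace Ω)
  (hF : ∀ k, F k ≤ mΩ) (hmono : Monotone F) (A : Finset α) (X : ℕ → Ω → α)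
  (hX : ∀ k, Measurable[F (k + 1)] (X k)) (hXA : ∀ k ω, X k ω ∈ A)
  (q : ℕ → α → Ω → ℝ) (hq0 : ∀ k, ∀ a ∈ A, ∀ ω, 0 ≤ q k a ω)
  (hq1 : ∀ k ω, ∑ a ∈ A, q k a ω = 1)
  (hq : ∀ k, ∀ a ∈ A, P[(X k ⁻¹' {a}).indicator (fun _ => (1 : ℝ)) | F k] =ᵐ[P] q k a)
  (f : ℕ → α → Ω → ℝ) (hf : ∀ k, ∀ a ∈ A, Measurable[F k] (f k a)) (m v : ℕ → ℝ) (b : ℝ) (T : ℕ)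
  (hbound : ∀ k < T, ∀ᵐ ω ∂P, (∀ a ∈ A, |f k a ω| ≤ b) ∧ ∑ a ∈ A, q k a ω * f k a ω ≤ m k ∧
    ∑ a ∈ A, q k a ω * f k a ω ^ 2 ≤ v k)

omit mΩ in
include hX hXA hf in
lemma measurable_comp_action (k : ℕ) (hmono : Monotone F) :
    Measurable[F (k + 1)] (fun ω => f k (X k ω) ω) := by
  classical
  have hsum : (fun ω => f k (X k ω) ω) =
      fun ω => ∑ a ∈ A, (X k ⁻¹' {a}).indicator (f k a) ω := by
    ext ω
    rw [Finset.sum_eq_single_of_mem (X k ω) (hXA k ω)]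
    · simp
    · intro a _ ha
      simp [Ne.symm ha]
  rw [hsum]
  refine Finset.measurable_sum _ fun a ha => ?_
  exact ((hf k a ha).mono (hmono k.le_succ) le_rfl).indicator (hX k (measurableSet_singleton a))

include hF hmono hX hXA hq0 hq1 hq hf hbound in
-- The supermartingale argument: conditioning on the past of the last round replaces its factor by a
-- finite average over `A`, which `sum_mul_exp_le` bounds by a constant. Integrability is carried
-- along in the induction.
lemma integral_exp_sum_le {s : ℝ} (hs : 0 ≤ s) (hsb : s * b ≤ 1) (t : ℕ) (ht : t ≤ T) :
    Integrable (fun ω => Real.exp (s * ∑ k ∈ Finset.range t, (f k (X k ω) ω - m k))) P ∧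
    ∫ ω, Real.exp (s * ∑ k ∈ Finset.range t, (f k (X k ω) ω - m k)) ∂P ≤
      Real.exp (s ^ 2 * (1 + s * b) / 2 * ∑ k ∈ Finset.range t, v k) := by
  induction t with
  | zero => simp
  | succ t ih =>
    obtain ⟨ihi, ihb⟩ := ih (by omega)
    set Y : Ω → ℝ := fun ω => Real.exp (s * ∑ k ∈ Finset.range t, (f k (X k ω) ω - m k)) with hY
    have hYm : Measurable[F t] Y := by
      refine Real.measurable_exp.comp (Measurable.const_mul ?_ s)
      refine Finset.measurable_sum _ fun k hk => Measurable.sub_const ?_ _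
      exact (measurable_comp_action F A X hX hXA f hf k hmono).mono
        (hmono (Finset.mem_range.mp hk)) le_rfl
    set g : α → Ω → ℝ := fun a ω => Y ω * Real.exp (s * (f t a ω - m t)) with hg
    have hgm : ∀ a ∈ A, Measurable[F t] (g a) := fun a ha =>
      hYm.mul (Real.measurable_exp.comp (((hf t a ha).sub_const _).const_mul s))
    have hgi : ∀ a ∈ A, Integrable (g a) P := by
      intro a ha
      refine ihi.mul_bdd (c := Real.exp (s * (b - m t))) ?_ ?_
      · exact ((Real.measurable_exp.comp (((hf t a ha).sub_const _).const_mul s)).mono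
          (hF t) le_rfl).aestronglyMeasurable
      · filter_upwards [hbound t (by omega)] with ω hω
        rw [Real.norm_eq_abs, Real.abs_exp]
        have := (abs_le.mp (hω.1 a ha)).2
        gcongr
    have e : (fun ω => Real.exp (s * ∑ k ∈ Finset.range (t + 1), (f k (X k ω) ω - m k))) =
        fun ω => g (X t ω) ω := by
      ext ω
      simp only [hg, hY]
      rw [← Real.exp_add, Finset.sum_range_succ, mul_add]
    obtain ⟨i1, i2, i3⟩ := integral_comp_action P (F t) (hF t) A (X t)
      ((hX t).mono (hF _) le_rfl) (hXA t) (q t) g (hq t) hgm hgi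
    rw [e]
    refine ⟨i1, ?_⟩
    rw [i3]
    calc ∫ ω, ∑ a ∈ A, q t a ω * g a ω ∂P
        ≤ ∫ ω, Y ω * Real.exp (s ^ 2 * (1 + s * b) / 2 * v t) ∂P := by
          refine integral_mono_ae (integrable_finsetSum _ i2) (ihi.mul_const _) ?_
          filter_upwards [hbound t (by omega)] with ω hω
          have h := sum_mul_exp_le A (fun a => q t a ω) (fun a => f t a ω)
            (fun a ha => hq0 t a ha ω) (hq1 t ω) hs hsb hω.1 hω.2.1 hω.2.2
          refine le_trans (le_of_eq ?_) (mul_le_mul_of_nonneg_left h (Real.exp_pos _).le)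
          rw [Finset.mul_sum]
          exact Finset.sum_congr rfl fun a _ => by simp only [hg]; ring
      _ = (∫ ω, Y ω ∂P) * Real.exp (s ^ 2 * (1 + s * b) / 2 * v t) := integral_mul_const _ _
      _ ≤ _ := by
          rw [Finset.sum_range_succ, mul_add (s ^ 2 * (1 + s * b) / 2), Real.exp_add]
          exact mul_le_mul_of_nonneg_right ihb (Real.exp_pos _).le

include hF hmono hX hXA hq0 hq1 hq hf hbound in
/-- A Bernstein (Freedman) inequality for sums of functions of adaptively sampled actions with
deterministic bounds for the conditional moments. -/
theorem measureReal_bernstein_le (hb : 0 < b)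
    (hV : 0 < ∑ k ∈ Finset.range T, v k) {G : ℝ} (hG : 0 ≤ G) :
    P.real {ω | ∑ k ∈ Finset.range T, m k + √(2 * (∑ k ∈ Finset.range T, v k) * G) + 3 * b * G <
      ∑ k ∈ Finset.range T, f k (X k ω) ω} ≤ Real.exp (-G) := by
  set V := ∑ k ∈ Finset.range T, v k with hVdef
  -- The parameter for Markov's inequality is `√(2 G / V)`, capped at `1 / b`. In the capped case `V
  -- ≤ 2 G b²`, so the left-hand side is at most `3 G`; this is the source of the constant `3`.
  obtain ⟨s, hs, hsb, hsc⟩ : ∃ s, 0 ≤ s ∧ s * b ≤ 1 ∧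
      s ^ 2 * (1 + s * b) / 2 * V + G ≤ s * (√(2 * V * G) + 3 * b * G) := by
    have hr := Real.sqrt_nonneg (2 * G / V)
    have hr2 := Real.sq_sqrt (show 0 ≤ 2 * G / V by positivity)
    set r := √(2 * G / V)
    have hrV : r ^ 2 * V = 2 * G := by rw [hr2]; field_simp
    have e : √(2 * V * G) = r * V := by
      rw [Real.sqrt_eq_iff_mul_self_eq (by positivity) (by positivity)]
      linear_combination -V * hrV
    rw [e]
    rcases le_or_gt (r * b) 1 with h | h
    · refine ⟨r, hr, h, ?_⟩
      have : 0 ≤ r * b * G := by positivity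
      nlinarith
    · refine ⟨1 / b, by positivity, by field_simp; exact le_rfl, ?_⟩
      have h1 : V ≤ 2 * G * b ^ 2 := by
        have h2 : 1 ≤ (r * b) ^ 2 := by nlinarith
        nlinarith
      have h3 : V / b ^ 2 ≤ 2 * G := by rwa [div_le_iff₀ (by positivity)]
      have h4 : (1 / b) ^ 2 * (1 + 1 / b * b) / 2 * V = V / b ^ 2 := by field_simp; ring
      have h5 : 1 / b * (r * V + 3 * b * G) = r * V / b + 3 * G := by field_simp
      rw [h4, h5]
      have : 0 ≤ r * V / b := by positivity
      linarith
  obtain ⟨hi, hint⟩ := integral_exp_sum_le P F hF hmono A X hX hXA q hq0 hq1 hq f hf m v b T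
    hbound hs hsb T le_rfl
  set Y : Ω → ℝ := fun ω => Real.exp (s * ∑ k ∈ Finset.range T, (f k (X k ω) ω - m k)) with hY
  set c := Real.exp (s ^ 2 * (1 + s * b) / 2 * V + G) with hc
  have hmarkov := mul_meas_ge_le_integral_of_nonneg
    (Filter.Eventually.of_forall fun ω => (Real.exp_pos _).le) hi c
  have hsub : {ω | ∑ k ∈ Finset.range T, m k + √(2 * V * G) + 3 * b * G <
      ∑ k ∈ Finset.range T, f k (X k ω) ω} ⊆ {ω | c ≤ Y ω} := by
    intro ω hω
    rw [Set.mem_ofPred_eq] at hω ⊢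
    refine Real.exp_le_exp.mpr (hsc.trans (mul_le_mul_of_nonneg_left ?_ hs))
    rw [Finset.sum_sub_distrib]
    linarith
  refine (measureReal_mono hsub).trans ?_
  have hcpos : 0 < c := Real.exp_pos _
  rw [← mul_le_mul_iff_of_pos_left hcpos]
  refine (hmarkov.trans hint).trans (le_of_eq ?_)
  rw [hc, ← Real.exp_add]
  congr 1; ring

end Bernstein

/-! ### The second moment matrix, its inverse, and the mixed distribution. -/

namespace ComBand

variable {n : ℕ} {A : Finset (Vec n)} {q : Vec n → ℝ}

lemma inner_eq_dotProduct (x y : Vec n) : inner ℝ x y = x.ofLp ⬝ᵥ y.ofLp := by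
  rw [EuclideanSpace.inner_eq_star_dotProduct, dotProduct_comm]; simp

lemma dotProduct_secondMoment_mulVec (A : Finset (Vec n)) (q : Vec n → ℝ) (u v : Vec n) :
    u.ofLp ⬝ᵥ (Matrix.mulVec (secondMoment A q) v.ofLp) =
      ∑ x ∈ A, q x * (inner ℝ x u * inner ℝ x v) := by
  rw [secondMoment, Matrix.sum_mulVec, dotProduct_sum]
  refine Finset.sum_congr rfl fun x _ => ?_
  rw [Matrix.smul_mulVec, Matrix.vecMulVec_mulVec, dotProduct_smul, inner_eq_dotProduct,
    inner_eq_dotProduct, dotProduct_comm x.ofLp u.ofLp]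
  simp [mul_comm]

lemma secondMoment_transpose (A : Finset (Vec n)) (q : Vec n → ℝ) :
    (secondMoment A q).transpose = secondMoment A q := by
  rw [secondMoment, Matrix.transpose_sum]
  refine Finset.sum_congr rfl fun x _ => ?_
  rw [Matrix.transpose_smul, Matrix.transpose_vecMulVec]

/-- The vector `C⁻¹ v` with `C = 𝔼_{y ∼ q} [y yᵀ]`. -/
noncomputable def invMoment (A : Finset (Vec n)) (q : Vec n → ℝ) (v : Vec n) : Vec n :=
  WithLp.toLp 2 (Matrix.mulVec (secondMoment A q)⁻¹ v.ofLp)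

lemma inner_lossEstimate (A : Finset (Vec n)) (q : Vec n → ℝ) (ℓ : ℝ) (x u : Vec n) :
    inner ℝ (lossEstimate A q ℓ x) u = ℓ * inner ℝ u (invMoment A q x) := by
  rw [real_inner_comm]
  simp only [inner_eq_dotProduct, lossEstimate, invMoment, dotProduct_smul, smul_eq_mul]

lemma inner_invMoment_comm (A : Finset (Vec n)) (q : Vec n → ℝ) (u v : Vec n) :
    inner ℝ u (invMoment A q v) = inner ℝ v (invMoment A q u) := by
  simp only [inner_eq_dotProduct, invMoment]
  rw [Matrix.dotProduct_mulVec, ← Matrix.mulVec_transpose, Matrix.transpose_nonsing_inv,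
    secondMoment_transpose, dotProduct_comm]

/-- The second moment of `q` is bounded below by `c`. -/
def MomentGE (A : Finset (Vec n)) (q : Vec n → ℝ) (c : ℝ) : Prop :=
  ∀ u : Vec n, c * ‖u‖ ^ 2 ≤ ∑ x ∈ A, q x * inner ℝ x u ^ 2

lemma momentGE_of_posSemidef {ν : Vec n → ℝ} {lam : ℝ}
    (h : (secondMoment A ν - lam • (1 : Matrix (Fin n) (Fin n) ℝ)).PosSemidef) :
    MomentGE A ν lam := by
  intro u
  have h1 := h.dotProduct_mulVec_nonneg u.ofLp
  rw [star_trivial, Matrix.sub_mulVec, dotProduct_sub, dotProduct_secondMoment_mulVec,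
    Matrix.smul_mulVec, Matrix.one_mulVec, dotProduct_smul, ← inner_eq_dotProduct,
    real_inner_self_eq_norm_sq, smul_eq_mul] at h1
  simp only [pow_two] at h1 ⊢
  linarith

variable {c : ℝ} (hc : 0 < c) (hC : MomentGE A q c)

include hc hC

/-- A kernel vector makes the quadratic form vanish, contradicting its positive lower bound. -/
lemma MomentGE.isUnit_det : IsUnit (secondMoment A q).det := by
  rw [isUnit_iff_ne_zero]
  intro h0
  obtain ⟨v, hv, hv0⟩ := Matrix.exists_mulVec_eq_zero_iff.mpr h0
  have h1 := dotProduct_secondMoment_mulVec A q (WithLp.toLp 2 v) (WithLp.toLp 2 v)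
  rw [hv0, dotProduct_zero] at h1
  have h2 := hC (WithLp.toLp 2 v)
  simp only [pow_two (inner ℝ _ _)] at h2
  rw [← h1] at h2
  have h3 : ‖(WithLp.toLp 2 v : Vec n)‖ ^ 2 ≤ 0 := by
    by_contra! h
    linarith [mul_pos hc h]
  have h4 : (WithLp.toLp 2 v : Vec n) = 0 := by
    rw [← norm_eq_zero]
    exact pow_eq_zero_iff two_ne_zero |>.mp (le_antisymm h3 (sq_nonneg _))
  exact hv (by simpa using congrArg WithLp.ofLp h4)

/-- This is `C C⁻¹ = I` in weak form; unbiasedness, the variance formula and the trace identity all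
come from it. -/
lemma MomentGE.sum_mul_inner_mul_inner_invMoment (u v : Vec n) :
    ∑ x ∈ A, q x * (inner ℝ x u * inner ℝ x (invMoment A q v)) = inner ℝ u v := by
  rw [← dotProduct_secondMoment_mulVec, invMoment, Matrix.mulVec_mulVec,
    Matrix.mul_nonsing_inv _ (hC.isUnit_det hc), Matrix.one_mulVec, inner_eq_dotProduct]

lemma MomentGE.sum_mul_sq_inner_invMoment (u : Vec n) :
    ∑ x ∈ A, q x * inner ℝ x (invMoment A q u) ^ 2 = inner ℝ u (invMoment A q u) := by
  simp only [pow_two]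
  rw [hC.sum_mul_inner_mul_inner_invMoment hc, real_inner_comm]

/-- For `w = C⁻¹ u`, the lower bound and Cauchy–Schwarz give `c ‖w‖² ≤ ⟨u, w⟩ ≤ ‖u‖ ‖w‖`. -/
lemma MomentGE.norm_invMoment_le (u : Vec n) : ‖invMoment A q u‖ ≤ ‖u‖ / c := by
  have h1 := hC (invMoment A q u)
  rw [hC.sum_mul_sq_inner_invMoment hc] at h1
  have h2 := h1.trans (real_inner_le_norm u (invMoment A q u))
  rw [le_div_iff₀ hc]
  rcases (norm_nonneg (invMoment A q u)).eq_or_lt with h | h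
  · rw [← h]; simp
  · refine le_of_mul_le_mul_right ?_ h
    nlinarith

lemma MomentGE.abs_inner_invMoment_le {B : ℝ} {u v : Vec n} (hu : ‖u‖ ≤ B) (hv : ‖v‖ ≤ B) :
    |inner ℝ u (invMoment A q v)| ≤ B ^ 2 / c := by
  have hB : 0 ≤ B := (norm_nonneg u).trans hu
  refine (abs_real_inner_le_norm _ _).trans ?_
  calc ‖u‖ * ‖invMoment A q v‖ ≤ B * (B / c) := by
        gcongr
        exact (hC.norm_invMoment_le hc v).trans (by gcongr)
    _ = _ := by ring

/-- The trace of `C⁻¹ C`, expanded in an orthonormal basis. -/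
lemma MomentGE.sum_mul_inner_invMoment_self :
    ∑ a ∈ A, q a * inner ℝ a (invMoment A q a) = n := by
  have h1 : ∀ a ∈ A, q a * inner ℝ a (invMoment A q a) = ∑ i, q a *
      (inner ℝ a (EuclideanSpace.basisFun (Fin n) ℝ i) *
        inner ℝ a (invMoment A q (EuclideanSpace.basisFun (Fin n) ℝ i))) := by
    intro a _
    rw [← Finset.mul_sum]
    congr 1
    rw [← OrthonormalBasis.sum_inner_mul_inner (EuclideanSpace.basisFun (Fin n) ℝ)]
    exact Finset.sum_congr rfl fun i _ => by rw [inner_invMoment_comm]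
  rw [Finset.sum_congr rfl h1, Finset.sum_comm]
  simp [hC.sum_mul_inner_mul_inner_invMoment hc]

/-- Unbiasedness of the loss estimator. -/
lemma MomentGE.sum_mul_inner_invMoment (L u : Vec n) :
    ∑ a ∈ A, q a * (inner ℝ L a * inner ℝ u (invMoment A q a)) = inner ℝ L u := by
  rw [← hC.sum_mul_inner_mul_inner_invMoment hc L u]
  refine Finset.sum_congr rfl fun a _ => ?_
  rw [real_inner_comm, inner_invMoment_comm]

omit hc hC

/-- Trace comparison: `n c ≤ B²`. -/
lemma MomentGE.card_mul_le (hC : MomentGE A q c) {B : ℝ} (hB : ∀ x ∈ A, ‖x‖ ≤ B)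
    (hq : IsDistribution A q) : n * c ≤ B ^ 2 := by
  have h1 : ∑ i : Fin n, c ≤ ∑ i, ∑ x ∈ A, q x *
      inner ℝ x (EuclideanSpace.basisFun (Fin n) ℝ i) ^ 2 := by
    refine Finset.sum_le_sum fun i _ => ?_
    have := hC (EuclideanSpace.basisFun (Fin n) ℝ i)
    rwa [OrthonormalBasis.norm_eq_one, one_pow, mul_one] at this
  rw [Finset.sum_comm] at h1
  simp only [Finset.sum_const, Finset.card_univ, Fintype.card_fin, nsmul_eq_mul,
    ← Finset.mul_sum] at h1
  refine h1.trans ?_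
  calc ∑ x ∈ A, q x * ∑ i, inner ℝ x (EuclideanSpace.basisFun (Fin n) ℝ i) ^ 2
      ≤ ∑ x ∈ A, q x * B ^ 2 := by
        refine Finset.sum_le_sum fun x hx => mul_le_mul_of_nonneg_left ?_ (hq.nonneg x hx)
        have : ∑ i, inner ℝ x (EuclideanSpace.basisFun (Fin n) ℝ i) ^ 2 = ‖x‖ ^ 2 := by
          rw [← OrthonormalBasis.sum_sq_norm_inner_left (EuclideanSpace.basisFun (Fin n) ℝ) x]
          simp
        rw [this]
        exact pow_le_pow_left₀ (norm_nonneg _) (hB x hx) 2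
    _ = B ^ 2 := by rw [← Finset.sum_mul, hq.sum_eq_one, one_mul]

/-- The squared mean is dominated by the second moment. -/
lemma sq_sum_mul_le {p f : Vec n → ℝ} (hp : IsDistribution A p) :
    (∑ x ∈ A, p x * f x) ^ 2 ≤ ∑ x ∈ A, p x * f x ^ 2 := by
  simpa using (even_two.convexOn_pow (𝕜 := ℝ)).map_sum_le (t := A) (w := p) (p := f) hp.nonneg
    hp.sum_eq_one (fun _ _ => Set.mem_univ _)

section Mixed

variable {ν : Vec n → ℝ} {γ η : ℝ} {S : Vec n}

lemma isDistribution_expWeights (hA : A.Nonempty) (η : ℝ) (S : Vec n) :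
    IsDistribution A (expWeights A η S) := by
  have h : 0 < ∑ y ∈ A, Real.exp (-η * inner ℝ S y) :=
    Finset.sum_pos (fun _ _ => Real.exp_pos _) hA
  refine ⟨fun x _ => div_nonneg (Real.exp_pos _).le h.le, ?_⟩
  simp only [expWeights, ← Finset.sum_div]
  exact div_self h.ne'

lemma isDistribution_mixed (hA : A.Nonempty) (hν : IsDistribution A ν) (h0 : 0 ≤ γ) (h1 : γ ≤ 1)
    (η : ℝ) (S : Vec n) : IsDistribution A (mixed A ν γ η S) := by
  have hp := isDistribution_expWeights hA η S
  refine ⟨fun x hx => ?_, ?_⟩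
  · exact add_nonneg (mul_nonneg (by linarith) (hp.nonneg x hx)) (mul_nonneg h0 (hν.nonneg x hx))
  · simp only [mixed]
    rw [Finset.sum_add_distrib, ← Finset.mul_sum, ← Finset.mul_sum, hp.sum_eq_one, hν.sum_eq_one]
    ring

/-- Turns averages under `p` into averages under `q`, where the moment identities hold. -/
lemma expWeights_le_mixed (hν : IsDistribution A ν) (h0 : 0 ≤ γ) {x : Vec n} (hx : x ∈ A) :
    (1 - γ) * expWeights A η S x ≤ mixed A ν γ η S x :=
  le_add_of_nonneg_right (mul_nonneg h0 (hν.nonneg x hx))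

/-- Only the exploration part of the mixture is used; the other part is nonnegative. -/
lemma momentGE_mixed (hA : A.Nonempty) {lam : ℝ} (hν : MomentGE A ν lam) (h0 : 0 ≤ γ)
    (h1 : γ ≤ 1) (η : ℝ) (S : Vec n) : MomentGE A (mixed A ν γ η S) (γ * lam) := by
  intro u
  calc γ * lam * ‖u‖ ^ 2 = γ * (lam * ‖u‖ ^ 2) := by ring
    _ ≤ γ * ∑ x ∈ A, ν x * inner ℝ x u ^ 2 := mul_le_mul_of_nonneg_left (hν u) h0
    _ ≤ ∑ x ∈ A, mixed A ν γ η S x * inner ℝ x u ^ 2 := by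
        rw [Finset.mul_sum]
        refine Finset.sum_le_sum fun x hx => ?_
        have := (isDistribution_expWeights hA η S).nonneg x hx
        have h2 : 0 ≤ (1 - γ) * expWeights A η S x := mul_nonneg (by linarith) this
        rw [mixed, ← mul_assoc]
        gcongr
        linarith

end Mixed

end ComBand

/-! ### Measurability of the algorithm with respect to the history. -/

namespace ComBand

section Measurability

variable {n : ℕ} {Ω : Type*} {mΩ : MeasurableSpace Ω} {A : Finset (Vec n)}

lemma measurable_lossEstimate {q : Ω → Vec n → ℝ} {ℓ : Ω → ℝ} {x : Ω → Vec n}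
    (hq : ∀ a ∈ A, Measurable fun ω => q ω a) (hℓ : Measurable ℓ) (hx : Measurable x) :
    Measurable fun ω => lossEstimate A (q ω) (ℓ ω) (x ω) := by
  have hC : Measurable fun ω => fun i j => secondMoment A (q ω) i j := by
    refine measurable_pi_iff.mpr fun i => measurable_pi_iff.mpr fun j => ?_
    simp only [secondMoment, Matrix.sum_apply, Matrix.smul_apply, smul_eq_mul]
    exact Finset.measurable_sum _ fun a ha => (hq a ha).mul_const _
  -- The inverse is the adjugate divided by the determinant, which is measurable in the entries even
  -- across singular matrices.
  have hinv : ∀ i j, Measurable fun M : Fin n → Fin n → ℝ => (Matrix.of M)⁻¹ i j := by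
    intro i j
    simp only [Matrix.inv_def, Ring.inverse_eq_inv']
    have h1 : Continuous fun M : Fin n → Fin n → ℝ => (Matrix.of M).det :=
      Continuous.matrix_det continuous_id
    have h2 : Continuous fun M : Fin n → Fin n → ℝ => (Matrix.of M).adjugate :=
      Continuous.matrix_adjugate continuous_id
    exact h1.measurable.inv.mul (h2.matrix_elem i j).measurable
  have hx' : ∀ i, Measurable fun ω => (x ω).ofLp i := fun i =>
    (EuclideanSpace.proj (𝕜 := ℝ) i : Vec n →L[ℝ] ℝ).continuous.measurable.comp hx
  refine (PiLp.continuous_toLp 2 _).measurable.comp (measurable_pi_iff.mpr fun i => ?_)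
  simp only [Pi.smul_apply, smul_eq_mul, Matrix.mulVec, dotProduct]
  refine hℓ.mul (Finset.measurable_sum _ fun j _ => ?_)
  exact Measurable.mul ((hinv i j).comp hC) (hx' j)

lemma measurable_expWeights {η : ℝ} {S : Ω → Vec n} (hS : Measurable S) (a : Vec n) :
    Measurable fun ω => expWeights A η (S ω) a := by
  have h : ∀ y : Vec n, Measurable fun ω => Real.exp (-η * inner ℝ (S ω) y) := fun y =>
    Real.measurable_exp.comp ((hS.inner measurable_const).const_mul _)
  exact (h a).div (Finset.measurable_sum _ fun y _ => h y)

lemma measurable_mixed {ν : Vec n → ℝ} {γ η : ℝ} {S : Ω → Vec n} (hS : Measurable S) (a : Vec n) :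
    Measurable fun ω => mixed A ν γ η (S ω) a :=
  ((measurable_expWeights hS a).const_mul _).add_const _

lemma measurable_cumEstimate {ν : Vec n → ℝ} {γ η : ℕ → ℝ} {X L : ℕ → Ω → Vec n} (k : ℕ)
    (hX : ∀ i < k, Measurable (X i)) (hL : ∀ i < k, Measurable (L i)) :
    Measurable fun ω => cumEstimate A ν γ η (fun i => X i ω)
      (fun i => inner ℝ (L i ω) (X i ω)) k := by
  induction k with
  | zero => exact measurable_const
  | succ k ih =>
    have hS := ih (fun i hi => hX i (by omega)) (fun i hi => hL i (by omega))
    exact hS.add (measurable_lossEstimate (fun a _ => measurable_mixed hS a)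
      ((hL k k.lt_succ_self).inner (hX k k.lt_succ_self)) (hX k k.lt_succ_self))

end Measurability

section PreHistory

variable {n : ℕ} {Ω : Type*} {X L : ℕ → Ω → Vec n}

lemma measurable_action_preHistory {i k : ℕ} (h : i < k) : Measurable[preHistory X L k] (X i) := by
  refine Measurable.of_comap_le (le_trans ?_ le_sup_left)
  exact le_sup_left.trans (le_iSup₂_of_le (f := fun i (_ : i < k) =>
    MeasurableSpace.comap (X i) inferInstance ⊔ MeasurableSpace.comap (L i) inferInstance)
    i h le_rfl)

lemma measurable_loss_preHistory {i k : ℕ} (h : i ≤ k) : Measurable[preHistory X L k] (L i) := by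
  refine Measurable.of_comap_le ?_
  rcases h.eq_or_lt with rfl | h
  · exact le_sup_right
  · refine le_trans ?_ le_sup_left
    exact le_sup_right.trans (le_iSup₂_of_le (f := fun i (_ : i < k) =>
      MeasurableSpace.comap (X i) inferInstance ⊔ MeasurableSpace.comap (L i) inferInstance)
      i h le_rfl)

lemma preHistory_le_of {m : MeasurableSpace Ω} {k : ℕ} (hX : ∀ i < k, Measurable[m] (X i))
    (hL : ∀ i ≤ k, Measurable[m] (L i)) : preHistory X L k ≤ m := by
  refine sup_le (iSup₂_le fun i hi => sup_le (hX i hi).comap_le (hL i hi.le).comap_le)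
    (hL k le_rfl).comap_le

lemma preHistory_mono : Monotone (preHistory X L) := fun _ _ h =>
  preHistory_le_of (fun _ hi => measurable_action_preHistory (hi.trans_le h))
    (fun _ hi => measurable_loss_preHistory (hi.trans h))

end PreHistory

/-! ### Conditional moments in a single round. -/

section Round

variable {n : ℕ} {A : Finset (Vec n)} {ν : Vec n → ℝ} {B lam γ η : ℝ} {S L : Vec n}

/-- The standing assumptions about the action set, the exploration distribution and the
exploration rate of one round. -/
structure RoundSetting (A : Finset (Vec n)) (ν : Vec n → ℝ) (B lam γ : ℝ) : Prop where
  nonempty : A.Nonempty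
  norm_le : ∀ x ∈ A, ‖x‖ ≤ B
  pos_bound : 0 < B
  pos_lam : 0 < lam
  isDistribution : IsDistribution A ν
  momentGE : MomentGE A ν lam
  rate_pos : 0 < γ
  rate_le : γ ≤ 1 / 2

variable (h : RoundSetting A ν B lam γ) (hL : ∀ x ∈ A, |inner ℝ L x| ≤ 1)

/-- The estimated loss of `x` if the action `a` is played. -/
noncomputable def estimatedLoss (A : Finset (Vec n)) (q : Vec n → ℝ) (L a x : Vec n) : ℝ :=
  inner ℝ (lossEstimate A q (inner ℝ L a) a) x

lemma estimatedLoss_eq (A : Finset (Vec n)) (q : Vec n → ℝ) (L a x : Vec n) :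
    estimatedLoss A q L a x = inner ℝ L a * inner ℝ x (invMoment A q a) :=
  inner_lossEstimate A q _ a x

/-- Multiplication with a loss bounded by one does not increase squares. -/
lemma sq_mul_le_of_abs_le_one {ℓ y : ℝ} (h : |ℓ| ≤ 1) : (ℓ * y) ^ 2 ≤ y ^ 2 := by
  rw [mul_pow]
  exact mul_le_of_le_one_left (sq_nonneg y) ((sq_le_one_iff_abs_le_one ℓ).mpr h)

include h

lemma RoundSetting.isDistribution_mixed (η : ℝ) (S : Vec n) :
    IsDistribution A (mixed A ν γ η S) :=
  ComBand.isDistribution_mixed h.nonempty h.isDistribution h.rate_pos.le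
    (by linarith [h.rate_le]) η S

lemma RoundSetting.momentGE_mixed (η : ℝ) (S : Vec n) :
    MomentGE A (mixed A ν γ η S) (γ * lam) :=
  ComBand.momentGE_mixed h.nonempty h.momentGE h.rate_pos.le (by linarith [h.rate_le]) η S

lemma RoundSetting.mul_pos : 0 < γ * lam := _root_.mul_pos h.rate_pos h.pos_lam

lemma RoundSetting.abs_inner_invMoment_le {x a : Vec n} (hx : x ∈ A) (ha : a ∈ A) :
    |inner ℝ x (invMoment A (mixed A ν γ η S) a)| ≤ B ^ 2 / (γ * lam) :=
  (h.momentGE_mixed η S).abs_inner_invMoment_le h.mul_pos (h.norm_le x hx) (h.norm_le a ha)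

include hL

lemma RoundSetting.abs_estimatedLoss_le {x a : Vec n} (hx : x ∈ A) (ha : a ∈ A) :
    |estimatedLoss A (mixed A ν γ η S) L a x| ≤ B ^ 2 / (γ * lam) := by
  rw [estimatedLoss_eq, abs_mul]
  exact (mul_le_of_le_one_left (abs_nonneg _) (hL a ha)).trans (h.abs_inner_invMoment_le hx ha)

/-- Moments of the error of the loss estimate of a fixed action. -/
lemma RoundSetting.estimate_error {x : Vec n} (hx : x ∈ A) :
    (∀ a ∈ A, |estimatedLoss A (mixed A ν γ η S) L a x - inner ℝ L x| ≤
      B ^ 2 / (γ * lam) + 1) ∧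
    ∑ a ∈ A, mixed A ν γ η S a *
      (estimatedLoss A (mixed A ν γ η S) L a x - inner ℝ L x) ≤ 0 ∧
    ∑ a ∈ A, mixed A ν γ η S a *
      (estimatedLoss A (mixed A ν γ η S) L a x - inner ℝ L x) ^ 2 ≤ B ^ 2 / (γ * lam) := by
  set q := mixed A ν γ η S with hqdef
  have hq : IsDistribution A q := h.isDistribution_mixed η S
  have hM : MomentGE A q (γ * lam) := h.momentGE_mixed η S
  have hmean : ∑ a ∈ A, q a * estimatedLoss A q L a x = inner ℝ L x := by
    simp only [estimatedLoss_eq]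
    exact hM.sum_mul_inner_invMoment h.mul_pos L x
  refine ⟨fun a ha => ?_, ?_, ?_⟩
  · exact (abs_sub _ _).trans (add_le_add (h.abs_estimatedLoss_le hL hx ha) (hL x hx))
  · simp only [mul_sub, Finset.sum_sub_distrib, hmean, ← Finset.sum_mul, hq.sum_eq_one]
    simp
  -- Variance is second moment minus squared mean; the second moment is at most `⟨x, C⁻¹ x⟩ ≤ B² /
  -- (γ λ)`.
  · have e : ∑ a ∈ A, q a * (estimatedLoss A q L a x - inner ℝ L x) ^ 2 =
        ∑ a ∈ A, q a * estimatedLoss A q L a x ^ 2 - inner ℝ L x ^ 2 := by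
      have : ∀ a ∈ A, q a * (estimatedLoss A q L a x - inner ℝ L x) ^ 2 =
          q a * estimatedLoss A q L a x ^ 2 -
            2 * inner ℝ L x * (q a * estimatedLoss A q L a x) + inner ℝ L x ^ 2 * q a :=
        fun a _ => by ring
      rw [Finset.sum_congr rfl this, Finset.sum_add_distrib, Finset.sum_sub_distrib,
        ← Finset.mul_sum, ← Finset.mul_sum, hmean, hq.sum_eq_one]
      ring
    have h1 : ∑ a ∈ A, q a * estimatedLoss A q L a x ^ 2 ≤
        ∑ a ∈ A, q a * inner ℝ a (invMoment A q x) ^ 2 := by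
      refine Finset.sum_le_sum fun a ha => mul_le_mul_of_nonneg_left ?_ (hq.nonneg a ha)
      rw [estimatedLoss_eq, inner_invMoment_comm]
      exact sq_mul_le_of_abs_le_one (hL a ha)
    rw [hM.sum_mul_sq_inner_invMoment h.mul_pos] at h1
    have h2 := (le_abs_self _).trans (h.abs_inner_invMoment_le (η := η) (S := S) hx hx)
    rw [e]
    linarith [sq_nonneg (inner ℝ L x : ℝ)]

omit hL in
/-- The mean of the exponential weights has bounded size in the metric of the inverse moment
matrix. -/
lemma RoundSetting.mean_invMoment_le :
    inner ℝ (∑ x ∈ A, expWeights A η S x • x)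
      (invMoment A (mixed A ν γ η S) (∑ x ∈ A, expWeights A η S x • x)) ≤ 2 := by
  set q := mixed A ν γ η S
  have hM : MomentGE A q (γ * lam) := h.momentGE_mixed η S
  have hp := isDistribution_expWeights h.nonempty η S
  set u := ∑ x ∈ A, expWeights A η S x • x with hu
  set y := inner ℝ u (invMoment A q u) with hy
  have h1 : y = ∑ x ∈ A, expWeights A η S x * inner ℝ x (invMoment A q u) := by
    rw [hy]; nth_rw 1 [hu]
    rw [sum_inner]
    simp [inner_smul_left]
  -- By Jensen and `p ≤ q / (1 - γ)`, `y² ≤ y / (1 - γ) ≤ 2 y`. Hence `y ≤ 2` whatever `n` and `λ`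
  -- are.
  have h2 := sq_sum_mul_le (f := fun x => inner ℝ x (invMoment A q u)) hp
  rw [← h1] at h2
  have h3 : (1 - γ) * ∑ x ∈ A, expWeights A η S x * inner ℝ x (invMoment A q u) ^ 2 ≤ y := by
    rw [hy, ← hM.sum_mul_sq_inner_invMoment h.mul_pos, Finset.mul_sum]
    refine Finset.sum_le_sum fun x hx => ?_
    rw [← mul_assoc]
    exact mul_le_mul_of_nonneg_right (expWeights_le_mixed h.isDistribution h.rate_pos.le hx)
      (sq_nonneg _)
  have h4 := h.rate_le
  have h5 : (1 / 2) * y ^ 2 ≤ y := by nlinarith [sq_nonneg y]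
  by_contra! h6
  nlinarith

/-- Moments of the difference between the incurred loss and the estimated loss of the
exponential weights. -/
lemma RoundSetting.weights_error :
    (∀ a ∈ A, |inner ℝ L a - ∑ x ∈ A, expWeights A η S x *
      estimatedLoss A (mixed A ν γ η S) L a x| ≤ B ^ 2 / (γ * lam) + 1) ∧
    ∑ a ∈ A, mixed A ν γ η S a * (inner ℝ L a - ∑ x ∈ A, expWeights A η S x *
      estimatedLoss A (mixed A ν γ η S) L a x) ≤ 2 * γ ∧
    ∑ a ∈ A, mixed A ν γ η S a * (inner ℝ L a - ∑ x ∈ A, expWeights A η S x *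
      estimatedLoss A (mixed A ν γ η S) L a x) ^ 2 ≤ 6 := by
  set q := mixed A ν γ η S with hqdef
  have hq : IsDistribution A q := h.isDistribution_mixed η S
  have hM : MomentGE A q (γ * lam) := h.momentGE_mixed η S
  have hp := isDistribution_expWeights h.nonempty η S
  set u := ∑ x ∈ A, expWeights A η S x • x with hu
  have huv : ∀ v : Vec n, inner ℝ v u = ∑ x ∈ A, expWeights A η S x * inner ℝ v x := by
    intro v
    rw [hu, inner_sum]
    simp [inner_smul_right]
  have e : ∀ a, ∑ x ∈ A, expWeights A η S x * estimatedLoss A q L a x =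
      inner ℝ L a * inner ℝ u (invMoment A q a) := by
    intro a
    rw [real_inner_comm _ u, huv, Finset.mul_sum]
    refine Finset.sum_congr rfl fun x _ => ?_
    rw [estimatedLoss_eq, real_inner_comm x]; ring
  refine ⟨fun a ha => ?_, ?_, ?_⟩
  · rw [add_comm (B ^ 2 / (γ * lam))]
    refine (abs_sub _ _).trans (add_le_add (hL a ha) ?_)
    refine (Finset.abs_sum_le_sum_abs _ _).trans ?_
    calc ∑ x ∈ A, |expWeights A η S x * estimatedLoss A q L a x|
        ≤ ∑ x ∈ A, expWeights A η S x * (B ^ 2 / (γ * lam)) := by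
          refine Finset.sum_le_sum fun x hx => ?_
          rw [abs_mul, abs_of_nonneg (hp.nonneg x hx)]
          exact mul_le_mul_of_nonneg_left (h.abs_estimatedLoss_le hL hx ha) (hp.nonneg x hx)
      _ = _ := by rw [← Finset.sum_mul, hp.sum_eq_one, one_mul]
  -- By unbiasedness the mean is `∑ (q - p) ⟨L, x⟩`, where `q - p = γ (ν - p)`.
  · simp only [e, mul_sub, Finset.sum_sub_distrib]
    rw [hM.sum_mul_inner_invMoment h.mul_pos, huv, ← Finset.sum_sub_distrib]
    calc ∑ x ∈ A, (q x * inner ℝ L x - expWeights A η S x * inner ℝ L x)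
        ≤ ∑ x ∈ A, (γ * ν x + γ * expWeights A η S x) := by
          refine Finset.sum_le_sum fun x hx => ?_
          have h1 := abs_le.mp (hL x hx)
          have h2 := mul_nonneg h.rate_pos.le (h.isDistribution.nonneg x hx)
          have h3 := mul_nonneg h.rate_pos.le (hp.nonneg x hx)
          rw [hqdef, mixed]
          nlinarith
      _ = 2 * γ := by
          rw [Finset.sum_add_distrib, ← Finset.mul_sum, ← Finset.mul_sum, hp.sum_eq_one,
            h.isDistribution.sum_eq_one]
          ring
  -- The gap equals `⟨L, a⟩ (1 - ⟨a, C⁻¹ u⟩)`, so its second moment is at most `2 + 2 ⟨u, C⁻¹ u⟩ ≤ 2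
  -- + 2 · 2`.
  · have h1 : ∀ a ∈ A, q a * (inner ℝ L a - ∑ x ∈ A, expWeights A η S x *
        estimatedLoss A q L a x) ^ 2 ≤ 2 * q a + 2 * (q a * inner ℝ a (invMoment A q u) ^ 2) := by
      intro a ha
      have : inner ℝ L a - ∑ x ∈ A, expWeights A η S x * estimatedLoss A q L a x =
          inner ℝ L a * (1 - inner ℝ a (invMoment A q u)) := by
        rw [e, inner_invMoment_comm]; ring
      rw [this]
      have h2 := sq_mul_le_of_abs_le_one (y := 1 - inner ℝ a (invMoment A q u)) (hL a ha)
      have h3 : (1 - inner ℝ a (invMoment A q u)) ^ 2 ≤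
          2 + 2 * (inner ℝ a (invMoment A q u) : ℝ) ^ 2 := by
        nlinarith [sq_nonneg (1 + inner ℝ a (invMoment A q u) : ℝ)]
      refine (mul_le_mul_of_nonneg_left (h2.trans h3) (hq.nonneg a ha)).trans
        (le_of_eq (by ring))
    refine (Finset.sum_le_sum h1).trans ?_
    rw [Finset.sum_add_distrib, ← Finset.mul_sum, ← Finset.mul_sum, hq.sum_eq_one,
      hM.sum_mul_sq_inner_invMoment h.mul_pos]
    linarith [h.mean_invMoment_le (η := η) (S := S)]

/-- Moments of the second order term. -/
lemma RoundSetting.second_order (hη : η = γ * lam / B ^ 2) :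
    (∀ a ∈ A, η * ∑ x ∈ A, expWeights A η S x * estimatedLoss A (mixed A ν γ η S) L a x ^ 2 ≤
      η / (1 - γ) * inner ℝ a (invMoment A (mixed A ν γ η S) a)) ∧
    (∀ a ∈ A, |η / (1 - γ) * inner ℝ a (invMoment A (mixed A ν γ η S) a)| ≤ 2) ∧
    ∑ a ∈ A, mixed A ν γ η S a *
      (η / (1 - γ) * inner ℝ a (invMoment A (mixed A ν γ η S) a)) ≤ η / (1 - γ) * n ∧
    ∑ a ∈ A, mixed A ν γ η S a *
      (η / (1 - γ) * inner ℝ a (invMoment A (mixed A ν γ η S) a)) ^ 2 ≤ 4 := by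
  have h1γ : 0 < 1 - γ := by linarith [h.rate_le]
  have hB := h.pos_bound
  have hlam := h.pos_lam
  have hγ := h.rate_pos
  have hη0 : 0 < η := by rw [hη]; positivity
  set q := mixed A ν γ η S with hqdef
  have hq : IsDistribution A q := h.isDistribution_mixed η S
  have hM : MomentGE A q (γ * lam) := h.momentGE_mixed η S
  have hp := isDistribution_expWeights h.nonempty η S
  have hb : ∀ a ∈ A, |η / (1 - γ) * inner ℝ a (invMoment A q a)| ≤ 2 := by
    intro a ha
    rw [abs_mul, abs_of_pos (by positivity)]
    calc η / (1 - γ) * |inner ℝ a (invMoment A q a)| ≤ η / (1 - γ) * (B ^ 2 / (γ * lam)) := by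
          gcongr
          exact h.abs_inner_invMoment_le ha ha
      _ = 1 / (1 - γ) := by rw [hη]; field_simp
      _ ≤ 2 := by rw [div_le_iff₀ h1γ]; linarith [h.rate_le]
  refine ⟨fun a ha => ?_, hb, ?_, ?_⟩
  · rw [div_mul_eq_mul_div, mul_div_assoc]
    refine mul_le_mul_of_nonneg_left ?_ hη0.le
    rw [le_div_iff₀ h1γ, ← hM.sum_mul_sq_inner_invMoment h.mul_pos, Finset.sum_mul]
    refine Finset.sum_le_sum fun x hx => ?_
    rw [estimatedLoss_eq, mul_right_comm, mul_comm _ (1 - γ)]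
    exact mul_le_mul (expWeights_le_mixed h.isDistribution hγ.le hx)
      (sq_mul_le_of_abs_le_one (hL a ha)) (sq_nonneg _) (hq.nonneg x hx)
  · refine le_of_eq ?_
    rw [← hM.sum_mul_inner_invMoment_self h.mul_pos, Finset.mul_sum]
    exact Finset.sum_congr rfl fun a _ => by ring
  · calc ∑ a ∈ A, q a * (η / (1 - γ) * inner ℝ a (invMoment A q a)) ^ 2
        ≤ ∑ a ∈ A, q a * 4 := by
          refine Finset.sum_le_sum fun a ha => mul_le_mul_of_nonneg_left ?_ (hq.nonneg a ha)
          rw [← sq_abs]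
          nlinarith [hb a ha, abs_nonneg (η / (1 - γ) * inner ℝ a (invMoment A q a))]
      _ = 4 := by rw [← Finset.sum_mul, hq.sum_eq_one, one_mul]

end Round

end ComBand

/-! ### Parameter sums and the pathwise decomposition of the regret. -/

namespace ComBand

lemma explorationRate_eq (k : ℕ) : explorationRate k = (cubeRoot (k + 1))⁻¹ / 2 := by
  rw [explorationRate, Real.rpow_neg (by positivity), cubeRoot]
  push_cast
  rfl

lemma explorationRate_pos (k : ℕ) : 0 < explorationRate k := by
  have := one_le_cubeRoot_succ k
  rw [explorationRate_eq]
  positivity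

lemma explorationRate_le (k : ℕ) : explorationRate k ≤ 1 / 2 := by
  rw [explorationRate_eq]
  have := inv_le_one_of_one_le₀ (one_le_cubeRoot_succ k)
  linarith

lemma explorationRate_succ_le (k : ℕ) : explorationRate (k + 1) ≤ explorationRate k := by
  have := one_le_cubeRoot_succ k
  rw [explorationRate_eq, explorationRate_eq]
  gcongr
  exact cubeRoot_mono (by omega)

lemma sq_div_explorationRate_mul (B lam : ℝ) (k : ℕ) :
    B ^ 2 / (explorationRate k * lam) = 2 * (B ^ 2 / lam) * cubeRoot (k + 1) := by
  have := one_le_cubeRoot_succ k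
  rw [explorationRate_eq]
  field_simp

lemma sum_explorationRate_le (T : ℕ) :
    ∑ k ∈ Finset.range T, explorationRate k ≤ 3 / 4 * cubeRoot T ^ 2 := by
  have := sum_inv_cubeRoot_le T
  simp only [explorationRate_eq, ← Finset.sum_div]
  linarith

lemma sum_explorationRate_sq_le (T : ℕ) :
    ∑ k ∈ Finset.range T, explorationRate k ^ 2 ≤ 3 / 4 * cubeRoot T := by
  have := sum_inv_cubeRoot_sq_le T
  simp only [explorationRate_eq, div_pow, ← Finset.sum_div]
  linarith

section Pathwise

variable {n : ℕ} (A : Finset (Vec n)) (ν : Vec n → ℝ) (γ η : ℝ) (S L a : Vec n)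

/-- Incurred loss minus the estimated loss of the exponential weights. -/
noncomputable def weightsGap : ℝ :=
  inner ℝ L a - ∑ x ∈ A, expWeights A η S x * estimatedLoss A (mixed A ν γ η S) L a x

/-- The second order term of a round. -/
noncomputable def secondOrder : ℝ :=
  η / (1 - γ) * inner ℝ a (invMoment A (mixed A ν γ η S) a)

/-- The error of the estimated loss of a fixed action. -/
noncomputable def estimateGap (x : Vec n) : ℝ :=
  estimatedLoss A (mixed A ν γ η S) L a x - inner ℝ L x

variable {A ν γ η S L a} {Ω : Type*} {mΩ : MeasurableSpace Ω}

lemma measurable_estimatedLoss {S L : Ω → Vec n} (hS : Measurable S) (hL : Measurable L)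
    (a x : Vec n) : Measurable fun ω => estimatedLoss A (mixed A ν γ η (S ω)) (L ω) a x :=
  (measurable_lossEstimate (fun b _ => measurable_mixed hS b) (hL.inner measurable_const)
    measurable_const).inner measurable_const

lemma measurable_weightsGap {S L : Ω → Vec n} (hS : Measurable S) (hL : Measurable L)
    (a : Vec n) : Measurable fun ω => weightsGap A ν γ η (S ω) (L ω) a :=
  (hL.inner measurable_const).sub (Finset.measurable_sum _ fun x _ =>
    (measurable_expWeights hS x).mul (measurable_estimatedLoss hS hL a x))

lemma measurable_estimateGap {S L : Ω → Vec n} (hS : Measurable S) (hL : Measurable L)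
    (a x : Vec n) : Measurable fun ω => estimateGap A ν γ η (S ω) (L ω) a x :=
  (measurable_estimatedLoss hS hL a x).sub (hL.inner measurable_const)

lemma measurable_secondOrder {S : Ω → Vec n} (hS : Measurable S) (a : Vec n) :
    Measurable fun ω => secondOrder A ν γ η (S ω) a := by
  have h : Measurable fun ω =>
      inner ℝ (lossEstimate A (mixed A ν γ η (S ω)) 1 a) a := by
    exact (measurable_lossEstimate (fun b _ => measurable_mixed hS b) measurable_const
      measurable_const).inner measurable_const
  simp only [inner_lossEstimate, one_mul] at h
  exact h.const_mul _

end Pathwise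

section Setting

variable {n : ℕ} {A : Finset (Vec n)} {ν : Vec n → ℝ} {B lam : ℝ}

/-- Decomposition of the regret against a fixed action along one run of the algorithm. -/
lemma regret_decomposition (h : ∀ k, RoundSetting A ν B lam (explorationRate k))
    {xs Ls S : ℕ → Vec n} (T : ℕ) (hxs : ∀ k, xs k ∈ A)
    (hS : S = cumEstimate A ν explorationRate (learningRate lam B) xs
      (fun i => inner ℝ (Ls i) (xs i)))
    (hL : ∀ k, ∀ x ∈ A, |inner ℝ (Ls k) x| ≤ 1) {x : Vec n} (hx : x ∈ A) :
    ∑ k ∈ Finset.range T, inner ℝ (Ls k) (xs k) - ∑ k ∈ Finset.range T, inner ℝ (Ls k) x ≤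
      ∑ k ∈ Finset.range T,
        weightsGap A ν (explorationRate k) (learningRate lam B k) (S k) (Ls k) (xs k) +
      (Real.exp 1 - 2) * ∑ k ∈ Finset.range T,
        secondOrder A ν (explorationRate k) (learningRate lam B k) (S k) (xs k) +
      ∑ k ∈ Finset.range T,
        estimateGap A ν (explorationRate k) (learningRate lam B k) (S k) (Ls k) (xs k) x +
      Real.log A.card / learningRate lam B T := by
  have hB := (h 0).pos_bound
  have hlam := (h 0).pos_lam
  have hη : ∀ k, 0 < learningRate lam B k := fun k => by
    have := explorationRate_pos k
    unfold learningRate; positivity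
  set η := learningRate lam B with hηdef
  set q : ℕ → Vec n → ℝ := fun k => mixed A ν (explorationRate k) (η k) (S k) with hq
  set z : ℕ → Vec n → ℝ := fun k y => estimatedLoss A (q k) (Ls k) (xs k) y with hz
  have hanti : ∀ k, η (k + 1) ≤ η k := fun k => by
    have := explorationRate_succ_le k
    simp only [hηdef, learningRate]
    gcongr
  -- The choice of `η` gives `η B² / (γ λ) = 1`, the range allowed by the exponential estimate.
  have hzb : ∀ k < T, ∀ y ∈ A, |η k * z k y| ≤ 1 := by
    intro k _ y hy
    rw [abs_mul, abs_of_pos (hη k)]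
    refine (mul_le_mul_of_nonneg_left ((h k).abs_estimatedLoss_le (hL k) hy (hxs k))
      (hη k).le).trans (le_of_eq ?_)
    have := (explorationRate_pos k).ne'
    simp only [hηdef, learningRate]
    field_simp
  have key := expWeights_regret_le A ⟨x, hx⟩ η hη hanti (fun k y => inner ℝ (S k) y) z
    (fun k => expWeights A (η k) (S k)) (fun y => by simp [hS, cumEstimate])
    (fun k y => by
      simp only [hz, hq, hS, cumEstimate, estimatedLoss]
      rw [inner_add_left])
    (fun k y => rfl) T hzb hx
  have hsec : ∑ k ∈ Finset.range T, η k * ∑ y ∈ A, expWeights A (η k) (S k) y * z k y ^ 2 ≤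
      ∑ k ∈ Finset.range T, secondOrder A ν (explorationRate k) (η k) (S k) (xs k) :=
    Finset.sum_le_sum fun k _ => ((h k).second_order (hL k) rfl).1 (xs k) (hxs k)
  have hST : inner ℝ (S T) x = ∑ k ∈ Finset.range T, z k x := by
    clear key
    induction T with
    | zero => simp [hS, cumEstimate]
    | succ k ih =>
      rw [Finset.sum_range_succ, ← ih (fun j hj => hzb j (by omega)) ?_]
      · simp only [hz, hq, hS, cumEstimate, estimatedLoss]
        rw [inner_add_left]
      · exact Finset.sum_le_sum fun k _ => ((h k).second_order (hL k) rfl).1 (xs k) (hxs k)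
  have he : 0 ≤ Real.exp 1 - 2 := by linarith [Real.exp_one_gt_d9]
  have hsec' := mul_le_mul_of_nonneg_left hsec he
  simp only [weightsGap, estimateGap, Finset.sum_sub_distrib]
  rw [hST] at key
  linarith

/-- The trivial bound for the regret. -/
lemma regret_le_two_mul (hA : A.Nonempty) {xs Ls : ℕ → Vec n} (T : ℕ) (hxs : ∀ k, xs k ∈ A)
    (hL : ∀ k, ∀ x ∈ A, |inner ℝ (Ls k) x| ≤ 1) : regret A hA xs Ls T ≤ 2 * T := by
  obtain ⟨x, hx, hxe⟩ := A.exists_mem_eq_inf' hA fun x => ∑ k ∈ Finset.range T, inner ℝ (Ls k) x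
  rw [regret, hxe, ← Finset.sum_sub_distrib]
  calc ∑ k ∈ Finset.range T, (inner ℝ (Ls k) (xs k) - inner ℝ (Ls k) x)
      ≤ ∑ k ∈ Finset.range T, (2 : ℝ) := Finset.sum_le_sum fun k _ => by
        linarith [(abs_le.mp (hL k x hx)).1, (abs_le.mp (hL k _ (hxs k))).2]
    _ = 2 * T := by simp [mul_comm]

end Setting

end ComBand

/-! ### From the deviation bounds to the two regret bounds. -/

/-- The real inequalities behind the two regret bounds. -/
lemma regret_bounds_of_deviation {R T r κ G ν lN e s₁ s₂ V : ℝ} (hr : 1 ≤ r) (hT : T = r ^ 3)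
    (hκ : 1 ≤ κ) (hG : 1 ≤ G) (hν : 0 ≤ ν) (hlN : lN ≤ G) (he0 : 0 ≤ e) (he1 : e ≤ 1)
    (hs₁ : s₁ ≤ 3 / 2 * r ^ 2) (hs₂ : s₂ ≤ ν * (3 / 4 * r ^ 2 + 3 / 2 * r))
    (hV : V ≤ 2 * κ * (3 / 4 * r ^ 4 + r)) (hRT : R ≤ 2 * T)
    (hR : R ≤ (s₁ + √(2 * (T * 6) * G) + 3 * (2 * κ * r + 1) * G) +
      e * (s₂ + √(2 * (T * 4) * G) + 3 * 2 * G) +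
      (√(2 * V * G) + 3 * (2 * κ * r + 1) * G) + lN * (4 * κ * r)) :
    R ≤ (√3 * √κ * √G + e * (3 / 4) * ν + 3 / 2) * r ^ 2 + 37 * (ν + (1 + κ) * G) * √T ∧
      R ≤ 41 * (√κ * √G + ν) * r ^ 2 := by
  -- In the application `r = T^(1/3)`, `κ = B² / λ`, `ν = n λ / B²`, `e = exp 1 - 2`, and `V` is the
  -- total variance of the estimated loss of a fixed action.
  have hr0 : 0 < r := by linarith
  have hT0 : 0 ≤ T := by rw [hT]; positivity
  have hκr : 1 ≤ κ * r := one_le_mul_of_one_le_of_one_le hκ hr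
  have hκrG : 1 ≤ κ * r * G := one_le_mul_of_one_le_of_one_le hκr hG
  have hG1 : 1 ≤ √G := Real.one_le_sqrt.mpr hG
  have hκ1 : 1 ≤ √κ := Real.one_le_sqrt.mpr hκ
  have hGG : √G ≤ G := Real.sqrt_le_iff.mpr ⟨by linarith, le_self_pow₀ hG two_ne_zero⟩
  have hw2 := Real.sq_sqrt hT0
  have hw0 := Real.sqrt_nonneg T
  have hrw : r ≤ √T := by
    refine Real.le_sqrt_of_sq_le ?_
    rw [hT]; exact pow_le_pow_right₀ hr (by norm_num)
  have hwr : √T ≤ r ^ 2 := by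
    refine Real.sqrt_le_iff.mpr ⟨by positivity, ?_⟩
    rw [hT, ← pow_mul]; exact pow_le_pow_right₀ hr (by norm_num)
  have e1 : √(2 * (T * 6) * G) ≤ 4 * (√T * √G) := by
    rw [← Real.sqrt_mul hT0]
    refine Real.sqrt_le_iff.mpr ⟨by positivity, ?_⟩
    rw [mul_pow, Real.sq_sqrt (by positivity)]
    linarith [mul_nonneg hT0 (show 0 ≤ G by linarith)]
  have e2 : √(2 * (T * 4) * G) ≤ 3 * (√T * √G) := by
    rw [← Real.sqrt_mul hT0]
    refine Real.sqrt_le_iff.mpr ⟨by positivity, ?_⟩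
    rw [mul_pow, Real.sq_sqrt (by positivity)]
    linarith [mul_nonneg hT0 (show 0 ≤ G by linarith)]
  -- The leading part of `2 V G` is `2 · (3/2) κ r⁴ G`, which yields the factor `√3`; the rest is
  -- split off by `√(a² + b²) ≤ a + b`.
  have e3 : √(2 * V * G) ≤ √3 * √κ * √G * r ^ 2 + 2 * (κ * r * G) := by
    have h1 : 2 * V * G ≤ (√3 * √κ * √G * r ^ 2) ^ 2 + (2 * (κ * r * G)) ^ 2 := by
      have : (√3 * √κ * √G * r ^ 2) ^ 2 = 3 * κ * G * r ^ 4 := by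
        simp only [mul_pow]
        rw [Real.sq_sqrt (by norm_num), Real.sq_sqrt (by linarith), Real.sq_sqrt (by linarith)]
        ring
      rw [this]
      have h2 : 2 * V * G ≤ 2 * (2 * κ * (3 / 4 * r ^ 4 + r)) * G := by gcongr
      have h3 : κ * r * G ≤ (κ * r * G) ^ 2 := le_self_pow₀ hκrG two_ne_zero
      linarith
    refine Real.sqrt_le_iff.mpr ⟨by positivity, h1.trans ?_⟩
    have : 0 ≤ (√3 * √κ * √G * r ^ 2) * (2 * (κ * r * G)) := by positivity
    rw [add_sq]
    linarith
  have e4 : e * (s₂ + √(2 * (T * 4) * G) + 3 * 2 * G) ≤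
      e * (3 / 4) * ν * r ^ 2 + 3 / 2 * (ν * r) + 3 * (√T * √G) + 6 * (κ * r * G) := by
    have h1 : e * s₂ ≤ e * (ν * (3 / 4 * r ^ 2 + 3 / 2 * r)) := mul_le_mul_of_nonneg_left hs₂ he0
    have h2 : e * (ν * r) ≤ ν * r := mul_le_of_le_one_left (by positivity) he1
    have h3 : e * √(2 * (T * 4) * G) ≤ √(2 * (T * 4) * G) :=
      mul_le_of_le_one_left (Real.sqrt_nonneg _) he1
    have h4 : e * G ≤ G := mul_le_of_le_one_left (by linarith) he1
    have h5 : G ≤ κ * r * G := le_mul_of_one_le_left (by linarith) hκr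
    linarith
  have hGr : G ≤ κ * r * G := le_mul_of_one_le_left (by linarith) hκr
  have e5 : lN * (4 * κ * r) ≤ 4 * (κ * r * G) := by
    have : lN * (4 * κ * r) ≤ G * (4 * κ * r) := by gcongr
    linarith
  -- The `30` collects `9 + 9` from the two range terms, `6` from the second order term, `2` from
  -- `e3` and `4` from `e5`; the `7` is `4 + 3`. Their sum `37` covers the remainder.
  have main : R ≤ (√3 * √κ * √G + e * (3 / 4) * ν + 3 / 2) * r ^ 2 + 3 / 2 * (ν * r) +
      7 * (√T * √G) + 30 * (κ * r * G) := by linarith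
  constructor
  · have h1 : ν * r ≤ ν * √T := by gcongr
    have h2 : √T * √G ≤ √T * G := by gcongr
    have h3 : κ * r * G ≤ κ * √T * G := by gcongr
    have h4 : 0 ≤ ν * √T := by positivity
    have h5 : 0 ≤ √T * G := by positivity
    have h6 : 0 ≤ κ * √T * G := by positivity
    linarith
  · have hν2 : 0 ≤ ν * r ^ 2 := by positivity
    -- With `u = √κ √G`, the remainder `κ r G = u² r` is at most `u r²` exactly in the first case,
    -- where the coefficients of `u r²` add up to `2 + 3/2 + 7 + 30 ≤ 41`. Otherwise `T = r³ ≤ u r²`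
    -- and the trivial bound on `R` is enough.
    rcases le_or_gt (√κ * √G) r with h | h
    · have hu1 : 1 ≤ √κ * √G := one_le_mul_of_one_le_of_one_le hκ1 hG1
      have hu2 : κ * G = (√κ * √G) ^ 2 := by
        rw [mul_pow, Real.sq_sqrt (by linarith), Real.sq_sqrt (by linarith)]
      have hGu : √G ≤ √κ * √G := le_mul_of_one_le_left (by linarith) hκ1
      have h1 : κ * r * G ≤ √κ * √G * r ^ 2 := by
        calc κ * r * G = (κ * G) * r := by ring
          _ = (√κ * √G) * (√κ * √G) * r := by rw [hu2]; ring
          _ ≤ (√κ * √G) * r * r := by gcongr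
          _ = _ := by ring
      have h2 : √T * √G ≤ r ^ 2 * (√κ * √G) := by gcongr
      have h3 : √3 ≤ 2 := Real.sqrt_le_iff.mpr ⟨by norm_num, by norm_num⟩
      have h4 : √3 * √κ * √G * r ^ 2 ≤ 2 * (√κ * √G * r ^ 2) := by
        rw [mul_assoc √3, mul_assoc √3]; gcongr
      have h5 : r ^ 2 ≤ √κ * √G * r ^ 2 := le_mul_of_one_le_left (by positivity) hu1
      have h6 : ν * r ≤ ν * r ^ 2 := by
        gcongr; exact le_self_pow₀ hr two_ne_zero
      have h7 : e * (3 / 4) * ν * r ^ 2 ≤ ν * r ^ 2 := by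
        have : e * (ν * r ^ 2) ≤ ν * r ^ 2 := mul_le_of_le_one_left hν2 he1
        linarith
      linarith
    · have h1 : T ≤ √κ * √G * r ^ 2 := by
        rw [hT, pow_succ, mul_comm]; gcongr
      have h2 : 0 ≤ √κ * √G * r ^ 2 := by positivity
      linarith

/-! ### Deviation bounds along a run and the union bound. -/

namespace ComBand

section Run

variable {n : ℕ} {A : Finset (Vec n)} {ν : Vec n → ℝ} {B lam : ℝ}
  {Ω : Type*} [mΩ : MeasurableSpace Ω] {P : Measure Ω} [IsProbabilityMeasure P]
  {X L : ℕ → Ω → Vec n}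

/-- The cumulative loss estimate along a run of the algorithm. -/
noncomputable def runEstimate (A : Finset (Vec n)) (ν : Vec n → ℝ) (B lam : ℝ)
    (X L : ℕ → Ω → Vec n) (k : ℕ) (ω : Ω) : Vec n :=
  cumEstimate A ν explorationRate (learningRate lam B) (fun i => X i ω)
    (fun i => inner ℝ (L i ω) (X i ω)) k

omit mΩ in
lemma measurable_runEstimate (k : ℕ) :
    Measurable[preHistory X L k] (runEstimate A ν B lam X L k) :=
  measurable_cumEstimate k (fun _ hi => measurable_action_preHistory hi)
    (fun _ hi => measurable_loss_preHistory hi.le)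

/-- Bernstein's inequality for a run of the algorithm. -/
lemma IsRun.measureReal_deviation_le
    (hrun : IsRun A ν explorationRate (learningRate lam B) P X L)
    (hset : ∀ k, RoundSetting A ν B lam (explorationRate k)) (f : ℕ → Vec n → Ω → ℝ)
    (hf : ∀ k, ∀ a ∈ A, Measurable[preHistory X L k] (f k a)) (m v : ℕ → ℝ) {b : ℝ} (T : ℕ)
    (hb : 0 < b) (hV : 0 < ∑ k ∈ Finset.range T, v k)
    (hbound : ∀ k < T, ∀ᵐ ω ∂P, (∀ a ∈ A, |f k a ω| ≤ b) ∧
      ∑ a ∈ A, mixed A ν (explorationRate k) (learningRate lam B k)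
        (runEstimate A ν B lam X L k ω) a * f k a ω ≤ m k ∧
      ∑ a ∈ A, mixed A ν (explorationRate k) (learningRate lam B k)
        (runEstimate A ν B lam X L k ω) a * f k a ω ^ 2 ≤ v k) {G : ℝ} (hG : 0 ≤ G) :
    P.real {ω | ∑ k ∈ Finset.range T, m k + √(2 * (∑ k ∈ Finset.range T, v k) * G) + 3 * b * G <
      ∑ k ∈ Finset.range T, f k (X k ω) ω} ≤ Real.exp (-G) :=
  measureReal_bernstein_le P (preHistory X L)
    (fun _ => preHistory_le_of (fun i _ => hrun.measurable_action i)
      (fun i _ => hrun.measurable_loss i))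
    preHistory_mono A X (fun k => measurable_action_preHistory k.lt_succ_self) hrun.action_mem
    (fun k a ω => mixed A ν (explorationRate k) (learningRate lam B k)
      (runEstimate A ν B lam X L k ω) a)
    (fun k a ha _ => ((hset k).isDistribution_mixed _ _).nonneg a ha)
    (fun k _ => ((hset k).isDistribution_mixed _ _).sum_eq_one)
    hrun.sample f hf m v b T hbound hb hV hG

variable (hrun : IsRun A ν explorationRate (learningRate lam B) P X L)
  (hset : ∀ k, RoundSetting A ν B lam (explorationRate k))
  (hL : ∀ᵐ ω ∂P, ∀ k, ∀ x ∈ A, |inner ℝ (L k ω) x| ≤ 1)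

lemma RoundSetting.sq_div_le {k T : ℕ} (h : RoundSetting A ν B lam (explorationRate k))
    (hk : k < T) : B ^ 2 / (explorationRate k * lam) ≤ 2 * (B ^ 2 / lam) * cubeRoot T := by
  have := h.pos_lam
  rw [sq_div_explorationRate_mul]
  gcongr
  exact cubeRoot_mono hk

include hrun hset hL

lemma IsRun.measureReal_weightsGap_le {T : ℕ} (hT : 1 ≤ T) {G : ℝ} (hG : 0 ≤ G) :
    P.real {ω | ∑ k ∈ Finset.range T, 2 * explorationRate k + √(2 * (T * 6) * G) +
        3 * (2 * (B ^ 2 / lam) * cubeRoot T + 1) * G <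
      ∑ k ∈ Finset.range T, weightsGap A ν (explorationRate k) (learningRate lam B k)
        (runEstimate A ν B lam X L k ω) (L k ω) (X k ω)} ≤ Real.exp (-G) := by
  have hT' : (0 : ℝ) < T := by exact_mod_cast hT
  have hlam := (hset 0).pos_lam
  have := cubeRoot_nonneg T
  have key := hrun.measureReal_deviation_le hset
    (fun k a ω => weightsGap A ν (explorationRate k) (learningRate lam B k)
      (runEstimate A ν B lam X L k ω) (L k ω) a)
    (fun k a _ => measurable_weightsGap (measurable_runEstimate k)
      (measurable_loss_preHistory le_rfl) a)
    (fun k => 2 * explorationRate k) (fun _ => 6) (b := 2 * (B ^ 2 / lam) * cubeRoot T + 1) T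
    (by positivity) (by simpa using (show 0 < T by omega)) (fun k hk => by
      filter_upwards [hL] with ω hω
      obtain ⟨h1, h2, h3⟩ := (hset k).weights_error (hω k) (η := learningRate lam B k)
        (S := runEstimate A ν B lam X L k ω)
      exact ⟨fun a ha => (h1 a ha).trans (by gcongr; exact (hset k).sq_div_le hk), h2, h3⟩) hG
  simpa using key

lemma IsRun.measureReal_secondOrder_le {T : ℕ} (hT : 1 ≤ T) {G : ℝ} (hG : 0 ≤ G) :
    P.real {ω | ∑ k ∈ Finset.range T, learningRate lam B k / (1 - explorationRate k) * n +
        √(2 * (T * 4) * G) + 3 * 2 * G <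
      ∑ k ∈ Finset.range T, secondOrder A ν (explorationRate k) (learningRate lam B k)
        (runEstimate A ν B lam X L k ω) (X k ω)} ≤ Real.exp (-G) := by
  have key := hrun.measureReal_deviation_le hset
    (fun k a ω => secondOrder A ν (explorationRate k) (learningRate lam B k)
      (runEstimate A ν B lam X L k ω) a)
    (fun k a _ => measurable_secondOrder (measurable_runEstimate k) a)
    (fun k => learningRate lam B k / (1 - explorationRate k) * n) (fun _ => 4) (b := 2) T
    (by positivity) (by simpa using (show 0 < T by omega)) (fun k hk => by
      filter_upwards [hL] with ω hω
      exact ((hset k).second_order (hω k) (η := learningRate lam B k)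
        (S := runEstimate A ν B lam X L k ω) rfl).2) hG
  simpa using key

lemma IsRun.measureReal_estimateGap_le {T : ℕ} (hT : 1 ≤ T) {G : ℝ} (hG : 0 ≤ G) {x : Vec n}
    (hx : x ∈ A) :
    P.real {ω | √(2 * (∑ k ∈ Finset.range T, 2 * (B ^ 2 / lam) * cubeRoot (k + 1)) * G) +
        3 * (2 * (B ^ 2 / lam) * cubeRoot T + 1) * G <
      ∑ k ∈ Finset.range T, estimateGap A ν (explorationRate k) (learningRate lam B k)
        (runEstimate A ν B lam X L k ω) (L k ω) (X k ω) x} ≤ Real.exp (-G) := by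
  have hB := (hset 0).pos_bound
  have hlam := (hset 0).pos_lam
  have := cubeRoot_nonneg T
  have key := hrun.measureReal_deviation_le hset
    (fun k a ω => estimateGap A ν (explorationRate k) (learningRate lam B k)
      (runEstimate A ν B lam X L k ω) (L k ω) a x)
    (fun k a _ => measurable_estimateGap (measurable_runEstimate k)
      (measurable_loss_preHistory le_rfl) a x)
    (fun _ => 0) (fun k => 2 * (B ^ 2 / lam) * cubeRoot (k + 1))
    (b := 2 * (B ^ 2 / lam) * cubeRoot T + 1) T (by positivity)
    (Finset.sum_pos (fun k _ => by
      have := one_le_cubeRoot_succ k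
      positivity) (Finset.nonempty_range_iff.mpr (by omega)))
    (fun k hk => by
      filter_upwards [hL] with ω hω
      obtain ⟨h1, h2, h3⟩ := (hset k).estimate_error (hω k) (η := learningRate lam B k)
        (S := runEstimate A ν B lam X L k ω) hx
      exact ⟨fun a ha => (h1 a ha).trans (by gcongr; exact (hset k).sq_div_le hk), h2,
        h3.trans (sq_div_explorationRate_mul B lam k).le⟩) hG
  simpa using key

/-- All deviation inequalities hold simultaneously with high probability. -/
lemma IsRun.exists_good_event {T : ℕ} (hT : 1 ≤ T) {δ : ℝ} (hδ : 0 < δ) (hδ1 : δ < 1) {G : ℝ}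
    (hG : G = Real.log ((A.card + 2) / δ)) (s : Set Ω)
    (hs : ∀ ω, (∀ k, ∀ x ∈ A, |inner ℝ (L k ω) x| ≤ 1) →
      ∑ k ∈ Finset.range T, weightsGap A ν (explorationRate k) (learningRate lam B k)
        (runEstimate A ν B lam X L k ω) (L k ω) (X k ω) ≤
      ∑ k ∈ Finset.range T, 2 * explorationRate k + √(2 * (T * 6) * G) +
        3 * (2 * (B ^ 2 / lam) * cubeRoot T + 1) * G →
      ∑ k ∈ Finset.range T, secondOrder A ν (explorationRate k) (learningRate lam B k)
        (runEstimate A ν B lam X L k ω) (X k ω) ≤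
      ∑ k ∈ Finset.range T, learningRate lam B k / (1 - explorationRate k) * n +
        √(2 * (T * 4) * G) + 3 * 2 * G →
      (∀ x ∈ A, ∑ k ∈ Finset.range T, estimateGap A ν (explorationRate k) (learningRate lam B k)
        (runEstimate A ν B lam X L k ω) (L k ω) (X k ω) x ≤
        √(2 * (∑ k ∈ Finset.range T, 2 * (B ^ 2 / lam) * cubeRoot (k + 1)) * G) +
        3 * (2 * (B ^ 2 / lam) * cubeRoot T + 1) * G) → ω ∈ s) :
    1 - δ ≤ P.real s := by
  have hratio : 1 ≤ ((A.card : ℝ) + 2) / δ := by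
    rw [le_div_iff₀ hδ]
    have := A.card.cast_nonneg (α := ℝ)
    linarith
  have hG0 : 0 ≤ G := hG ▸ Real.log_nonneg hratio
  have hexp : Real.exp (-G) = δ / (A.card + 2) := by
    rw [Real.exp_neg, hG, Real.exp_log (by linarith), inv_div]
  have b1 := hrun.measureReal_weightsGap_le hset hL hT hG0
  have b2 := hrun.measureReal_secondOrder_le hset hL hT hG0
  have b3 := fun x hx => hrun.measureReal_estimateGap_le hset hL hT hG0 (x := x) hx
  rw [hexp] at b1 b2
  simp only [hexp] at b3
  set E₁ := {ω | _ < ∑ k ∈ Finset.range T, weightsGap A ν (explorationRate k)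
    (learningRate lam B k) (runEstimate A ν B lam X L k ω) (L k ω) (X k ω)}
  set E₂ := {ω | _ < ∑ k ∈ Finset.range T, secondOrder A ν (explorationRate k)
    (learningRate lam B k) (runEstimate A ν B lam X L k ω) (X k ω)}
  set E₃ : Vec n → Set Ω := fun x =>
    {ω | √(2 * (∑ k ∈ Finset.range T, 2 * (B ^ 2 / lam) * cubeRoot (k + 1)) * G) +
        3 * (2 * (B ^ 2 / lam) * cubeRoot T + 1) * G <
      ∑ k ∈ Finset.range T, estimateGap A ν (explorationRate k) (learningRate lam B k)
        (runEstimate A ν B lam X L k ω) (L k ω) (X k ω) x} with hE₃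
  set E₀ := {ω | ¬ ∀ k, ∀ x ∈ A, |inner ℝ (L k ω) x| ≤ 1} with hE₀
  have b0 : P.real E₀ = 0 := by
    rw [measureReal_def, show P E₀ = 0 from hL]; rfl
  have b4 : P.real (⋃ x ∈ A, E₃ x) ≤ A.card * (δ / (A.card + 2)) := by
    refine (measureReal_biUnion_finset_le A E₃).trans ?_
    refine (Finset.sum_le_sum b3).trans (le_of_eq ?_)
    rw [Finset.sum_const, nsmul_eq_mul]
  -- Subadditivity over a cover, rather than passing to complements, avoids any measurability of
  -- `s`.
  have hcover : (Set.univ : Set Ω) ⊆ s ∪ (E₀ ∪ (E₁ ∪ (E₂ ∪ ⋃ x ∈ A, E₃ x))) := by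
    intro ω _
    by_contra hω
    simp only [Set.mem_union, not_or, Set.mem_iUnion, not_exists] at hω
    obtain ⟨h, h0, h1, h2, h3⟩ := hω
    exact h (hs ω (not_not.mp h0) (not_lt.mp h1) (not_lt.mp h2) fun x hx => not_lt.mp (h3 x hx))
  have h1 := measureReal_mono (μ := P) hcover
  rw [probReal_univ] at h1
  have h2 := measureReal_union_le (μ := P) s (E₀ ∪ (E₁ ∪ (E₂ ∪ ⋃ x ∈ A, E₃ x)))
  have h3 := measureReal_union_le (μ := P) E₀ (E₁ ∪ (E₂ ∪ ⋃ x ∈ A, E₃ x))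
  have h4 := measureReal_union_le (μ := P) E₁ (E₂ ∪ ⋃ x ∈ A, E₃ x)
  have h5 := measureReal_union_le (μ := P) E₂ (⋃ x ∈ A, E₃ x)
  have h6 : δ / (A.card + 2) + δ / (A.card + 2) + A.card * (δ / (A.card + 2)) = δ := by
    field_simp
    ring
  linarith

end Run

lemma sum_learningRate_div_le {B lam : ℝ} (hB : 0 < B) (hlam : 0 < lam) (n T : ℕ) :
    ∑ k ∈ Finset.range T, learningRate lam B k / (1 - explorationRate k) * n ≤
      n * (lam / B ^ 2) * (3 / 4 * cubeRoot T ^ 2 + 3 / 2 * cubeRoot T) := by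
  have h1 : ∀ k ∈ Finset.range T, learningRate lam B k / (1 - explorationRate k) * n ≤
      n * (lam / B ^ 2) * (explorationRate k + 2 * explorationRate k ^ 2) := by
    intro k _
    have h0 := explorationRate_pos k
    have h2 := explorationRate_le k
    have h3 : explorationRate k / (1 - explorationRate k) ≤
        explorationRate k + 2 * explorationRate k ^ 2 := by
      rw [div_le_iff₀ (by linarith)]
      nlinarith [mul_nonneg (sq_nonneg (explorationRate k)) (sub_nonneg.mpr h2)]
    calc learningRate lam B k / (1 - explorationRate k) * n =
        n * (lam / B ^ 2) * (explorationRate k / (1 - explorationRate k)) := by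
          rw [learningRate]; ring
      _ ≤ _ := by gcongr
  refine (Finset.sum_le_sum h1).trans ?_
  rw [← Finset.mul_sum, Finset.sum_add_distrib, ← Finset.mul_sum]
  have h2 := sum_explorationRate_le T
  have h3 := sum_explorationRate_sq_le T
  exact mul_le_mul_of_nonneg_left (by linarith) (by positivity)

lemma inv_learningRate_le {B lam : ℝ} (hlam : 0 < lam) {T : ℕ} (hT : 1 ≤ T) :
    (learningRate lam B T)⁻¹ ≤ 4 * (B ^ 2 / lam) * cubeRoot T := by
  have h1 := sq_div_explorationRate_mul B lam T
  rw [learningRate, inv_div, h1]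
  have h2 : cubeRoot (T + 1) ≤ 2 * cubeRoot T := by
    have h3 := cubeRoot_nonneg T
    refine le_of_pow_le_pow_left₀ three_ne_zero (by positivity) ?_
    rw [mul_pow, cubeRoot_pow_three, cubeRoot_pow_three]
    have : (1 : ℝ) ≤ T := by exact_mod_cast hT
    push_cast
    linarith
  have h4 : 2 * (B ^ 2 / lam) * cubeRoot (T + 1) ≤ 2 * (B ^ 2 / lam) * (2 * cubeRoot T) := by
    gcongr
  linarith

lemma regret_eq_zero_of_dim_zero {A : Finset (Vec 0)} (hA : A.Nonempty) (xs Ls : ℕ → Vec 0)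
    (T : ℕ) : regret A hA xs Ls T = 0 := by
  have h : ∀ u v : Vec 0, (inner ℝ u v : ℝ) = 0 := fun u v => by
    rw [Subsingleton.elim u 0, inner_zero_left]
  simp [regret, h]

end ComBand

theorem theorem2 :
    ∃ C₁ C₂ : ℝ, 0 < C₁ ∧ 0 < C₂ ∧
      ∀ (n : ℕ) (A : Finset (ComBand.Vec n)) (hA : A.Nonempty) (ν : ComBand.Vec n → ℝ) (B lam : ℝ),
        0 < B → (∀ x ∈ A, ‖x‖ ≤ B) →
        0 < lam → ComBand.IsDistribution A ν →
        (ComBand.secondMoment A ν - lam • (1 : Matrix (Fin n) (Fin n) ℝ)).PosSemidef →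
        ∀ (Ω : Type*) [MeasurableSpace Ω] (P : Measure Ω) [IsProbabilityMeasure P]
          (X L : ℕ → Ω → ComBand.Vec n),
          ComBand.IsRun A ν ComBand.explorationRate (ComBand.learningRate lam B) P X L →
          (∀ k, ∀ᵐ ω ∂P, ∀ x ∈ A, |inner ℝ (L k ω) x| ≤ 1) →
          ∀ (T : ℕ), 1 ≤ T → ∀ (δ : ℝ), 0 < δ → δ < 1 →
            1 - δ ≤ P.real {ω |
              ComBand.regret A hA (fun k => X k ω) (fun k => L k ω) T ≤
                (√3 * B / √lam * √(Real.log ((A.card + 2) / δ))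
                    + n * (3 * (Real.exp 1 - 2) * lam / (4 * B ^ 2)) + 3 / 2)
                  * (T : ℝ) ^ (2 / 3 : ℝ)
                + C₁ * (n * (lam / B ^ 2)
                    + (1 + B ^ 2 / lam) * Real.log ((A.card + 2) / δ)) * √T ∧
              ComBand.regret A hA (fun k => X k ω) (fun k => L k ω) T ≤
                C₂ * (B / √lam * √(Real.log ((A.card + 2) / δ)) + n * (lam / B ^ 2))
                  * (T : ℝ) ^ (2 / 3 : ℝ)} := by
  refine ⟨37, 41, by norm_num, by norm_num, ?_⟩
  intro n A hA ν B lam hB hAB hlam hν hpsd Ω _ P _ X L hrun hL T hT δ hδ hδ1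
  have hset : ∀ k, ComBand.RoundSetting A ν B lam (ComBand.explorationRate k) := fun k =>
    ⟨hA, hAB, hB, hlam, hν, ComBand.momentGE_of_posSemidef hpsd,
      ComBand.explorationRate_pos k, ComBand.explorationRate_le k⟩
  have he0 : 0 ≤ Real.exp 1 - 2 := by linarith [Real.exp_one_gt_d9]
  have he1 : Real.exp 1 - 2 ≤ 1 := by linarith [Real.exp_one_lt_d9]
  have hN : (1 : ℝ) ≤ A.card := by exact_mod_cast hA.card_pos
  have hratio : Real.exp 1 ≤ ((A.card : ℝ) + 2) / δ := by
    rw [le_div_iff₀ hδ]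
    nlinarith [Real.exp_one_lt_d9, Real.exp_pos 1]
  have hratio0 : 0 < ((A.card : ℝ) + 2) / δ := by positivity
  set G := Real.log ((A.card + 2) / δ) with hGdef
  have hG : 1 ≤ G := by
    rw [hGdef, Real.le_log_iff_exp_le hratio0]; exact hratio
  have hlN : Real.log A.card ≤ G := by
    refine Real.log_le_log (by linarith) ?_
    rw [le_div_iff₀ hδ]
    nlinarith
  refine hrun.exists_good_event hset (ae_all_iff.mpr hL) hT hδ hδ1 hGdef _ ?_
  intro ω hω h1 h2 h3
  rw [Set.mem_ofPred_eq, ← cubeRoot_pow_two]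
  rcases Nat.eq_zero_or_pos n with rfl | hn
  · rw [ComBand.regret_eq_zero_of_dim_zero]
    constructor <;> positivity
  have hκ : 1 ≤ B ^ 2 / lam := by
    have h4 := (ComBand.momentGE_of_posSemidef hpsd).card_mul_le hAB hν
    have h5 : (1 : ℝ) ≤ n := by exact_mod_cast hn
    rw [le_div_iff₀ hlam]
    nlinarith
  obtain ⟨x, hx, hxe⟩ := A.exists_mem_eq_inf' hA
    fun x => ∑ k ∈ Finset.range T, inner ℝ (L k ω) x
  have hdec := ComBand.regret_decomposition hset T (fun k => hrun.action_mem k ω) rfl hω hx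
  have hr : 1 ≤ cubeRoot T := by
    obtain ⟨t, rfl⟩ := Nat.exists_eq_add_of_le' hT
    exact one_le_cubeRoot_succ t
  have hlast : Real.log A.card / ComBand.learningRate lam B T ≤
      Real.log A.card * (4 * (B ^ 2 / lam) * cubeRoot T) := by
    rw [div_eq_mul_inv]
    exact mul_le_mul_of_nonneg_left (ComBand.inv_learningRate_le hlam hT) (Real.log_nonneg hN)
  have hreg : ComBand.regret A hA (fun k => X k ω) (fun k => L k ω) T =
      ∑ k ∈ Finset.range T, inner ℝ (L k ω) (X k ω) -
        ∑ k ∈ Finset.range T, inner ℝ (L k ω) x := by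
    rw [ComBand.regret, hxe]
  have hR := hreg.trans_le (hdec.trans (add_le_add (add_le_add (add_le_add h1
    (mul_le_mul_of_nonneg_left h2 he0)) (h3 x hx)) hlast))
  have key := regret_bounds_of_deviation hr (cubeRoot_pow_three T).symm hκ hG
    (show 0 ≤ (n : ℝ) * (lam / B ^ 2) by positivity) hlN he0 he1
    (by
      rw [← Finset.mul_sum]
      linarith [ComBand.sum_explorationRate_le T])
    (ComBand.sum_learningRate_div_le hB hlam n T)
    (by
      rw [← Finset.mul_sum]
      exact mul_le_mul_of_nonneg_left (sum_cubeRoot_le T) (by positivity))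
    (ComBand.regret_le_two_mul hA T (fun k => hrun.action_mem k ω) hω) hR
  have hsq : √(B ^ 2 / lam) = B / √lam := by
    rw [Real.sqrt_div (sq_nonneg B), Real.sqrt_sq hB.le]
  rw [hsq] at key
  refine ⟨key.1.trans (le_of_eq ?_), key.2⟩
  ring
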